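/- Let $N\ge 1$. Ordered searching is the partial function $F$ whose valid inputs are the strings $x\in\{0,1\}^N$ with $x_1\le x_2\le\dots\le x_N$ and $x_N=1$, and $F(x)\in\{1,\dots,N\}$ is the position of the leftmost $1$ of $x$. Let $\Gamma$ be the $2^N\times 2^N$ real matrix with $\Gamma[x,y]=\frac{1}{|F(x)-F(y)|}$ if $x$ and $y$ are valid and distinct, and $\Gamma[x,y]=0$ otherwise. For $1\le i\le N$ let $\Gamma_i[x,y]=\Gamma[x,y]$ if $x_i\ne y_i$ and $\Gamma_i[x,y]=0$ if $x_i=y_i$. Let $\lambda$ denote the spectral norm and $H_n=\sum_{k=1}^n \frac1k$. A quantum query algorithm with $T$ queries computes, on oracle $x$, the state $U_T O_x U_{T-1}\cdots U_1 O_x U_0|0\rangle$, where the $U_t$ are arbitrary unitaries that do not depend on $x$, acting on a finite-dimensional space with basis $|i;z\rangle$, $0\le i\le N$, and $O_x|0;z\rangle=|0;z\rangle$, $O_x|i;z\rangle=(-1)^{x_i}|i;z\rangle$ for $1\le i\le N$; the state is then measured in the computational basis and the output is a function of the outcome. Let $Q_\varepsilon(F)$ be the least $T$ for which some such algorithm outputs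 $F(x)$ with probability at least $1-\varepsilon$ on every valid $x$. Then: 1. $\Gamma$ is a spectral adversary matrix for $F$: it is symmetric, has non-negative entries, and vanishes at every pair of valid inputs with $F(x)=F(y)$ and at every pair that contains an invalid input. 2. $\lambda(\Gamma)\ge H_{N-1}\ge \ln N$. 3. If $N\ge 2$, then $\lambda(\Gamma_i)\le\lambda(\Gamma_{\lfloor N/2\rfloor})$ for all $1\le i\le N$. The infinite Hilbert matrix $\left[\frac{1}{r+s-1}\right]_{r,s\ge1}$ is the matrix of a bounded operator on $\ell^2$ of norm exactly $\pi$, and for every $N \geq 1$ and $1\le i\le N$, $\lambda(\Gamma_i)$ is at most this norm, so $\lambda(\Gamma_i)\le\pi$. 4. For every $0\le\varepsilon\le\frac12$, with $\varepsilon'=2\sqrt{\varepsilon(1-\varepsilon)}$, $$Q_\varepsilon(F)\ \ge\ (1-\varepsilon')\,\frac{\ln N}{\pi}.$$ 5. In particular $0.45\log_2 N\le 2.04\cdot Q_0(F)$: an exact algorithm for ordered searching that uses $0.45\log_2 N$ queries is within a factor of $2.04$ of optimal. -/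

import Mathlib

namespace OrderedSearch

noncomputable section

/-! ### Quantum query algorithms with a phase oracle -/

/-- Computational basis `|i; z⟩` of an algorithm on `N`-bit oracles: `none` is the non-query index
`0`, `some i` is the index `i + 1` of `{1, …, N}`, and `z` is the content of the work space. -/
abbrev QBasis (N w : ℕ) : Type := Option (Fin N) × Fin (w + 1)

/-- The phase oracle: `|0; z⟩ ↦ |0; z⟩` and `|i; z⟩ ↦ (-1)^{x_i} |i; z⟩` for `1 ≤ i ≤ N`. -/
def phaseOracle {N : ℕ} (w : ℕ) (x : Fin N → Bool) : Matrix (QBasis N w) (QBasis N w) ℂ :=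
  Matrix.diagonal fun b =>
    match b.1 with
    | none => 1
    | some i => if x i = true then -1 else 1

/-- A quantum query algorithm on `N`-bit oracles with outputs in `α`: the number of queries, the
dimension of the work space, the input-independent unitaries (only `U 0, …, U queries` are used),
and the output that is read off the measured basis state. -/
structure QueryAlgorithm (N : ℕ) (α : Type) where
  queries : ℕ
  work : ℕ
  U : ℕ → Matrix.unitaryGroup (QBasis N work) ℂ
  out : QBasis N work → α

/-- The state `U_t O_x U_{t-1} ⋯ U_1 O_x U_0 |0⟩` after `t` queries. -/
def QueryAlgorithm.state {N : ℕ} {α : Type} (A : QueryAlgorithm N α) (x : Fin N → Bool) :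
    ℕ → QBasis N A.work → ℂ
  | 0 => Matrix.mulVec (A.U 0 : Matrix (QBasis N A.work) (QBasis N A.work) ℂ)
      (Pi.single (none, 0) 1)
  | t + 1 => Matrix.mulVec (A.U (t + 1) : Matrix (QBasis N A.work) (QBasis N A.work) ℂ)
      (Matrix.mulVec (phaseOracle A.work x) (A.state x t))

open Classical in
/-- The probability that measuring the final state on oracle `x` yields the output `a`. -/
def QueryAlgorithm.outputProb {N : ℕ} {α : Type} (A : QueryAlgorithm N α) (x : Fin N → Bool)
    (a : α) : ℝ :=
  ∑ b : QBasis N A.work, if A.out b = a then ‖A.state x A.queries b‖ ^ 2 else 0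

/-- `A` computes the function `F`, restricted to the promise `S`, with error at most `ε`. -/
def QueryAlgorithm.Computes {N : ℕ} {α : Type} (A : QueryAlgorithm N α) (S : Set (Fin N → Bool))
    (F : (Fin N → Bool) → α) (ε : ℝ) : Prop :=
  ∀ x ∈ S, 1 - ε ≤ A.outputProb x (F x)

/-- The quantum query complexity `Q_ε(F)` of the partial function `F` with domain `S`. -/
def queryComplexity {N : ℕ} {α : Type} (S : Set (Fin N → Bool)) (F : (Fin N → Bool) → α)
    (ε : ℝ) : ℕ∞ :=
  ⨅ (A : QueryAlgorithm N α) (_ : A.Computes S F ε), (A.queries : ℕ∞)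

/-! ### Adversary matrices -/

/-- The spectral norm (`ℓ²` operator norm) of a real square matrix. -/
def specNorm {ι : Type} [Fintype ι] [DecidableEq ι] (M : Matrix ι ι ℝ) : ℝ :=
  ‖Matrix.toEuclideanCLM (n := ι) (𝕜 := ℝ) M‖

/-- Spectral adversary matrices for a partial function `F` with domain `S`. -/
structure IsAdversaryMatrix {N : ℕ} {α : Type} (S : Set (Fin N → Bool))
    (F : (Fin N → Bool) → α) (G : Matrix (Fin N → Bool) (Fin N → Bool) ℝ) : Prop where
  symm : G.IsSymm
  nonneg : ∀ x y, 0 ≤ G x y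
  eq_zero_of_eq : ∀ x ∈ S, ∀ y ∈ S, F x = F y → G x y = 0
  eq_zero_of_invalid : ∀ x y, x ∉ S ∨ y ∉ S → G x y = 0

/-- The matrix `Γ_i`: the entries of `Γ` at pairs of inputs that differ in the bit `i`. -/
def queryMatrix {N : ℕ} (G : Matrix (Fin N → Bool) (Fin N → Bool) ℝ) (i : Fin N) :
    Matrix (Fin N → Bool) (Fin N → Bool) ℝ :=
  fun x y => if x i ≠ y i then G x y else 0

/-! ### Ordered searching -/

/-- The promise of ordered searching: `x_1 ≤ x_2 ≤ ⋯ ≤ x_N` and `x_N = 1`. -/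
def validInputs (N : ℕ) : Set (Fin N → Bool) :=
  {x | Monotone x ∧ ∀ i : Fin N, (i : ℕ) + 1 = N → x i = true}

/-- The position in `{1, …, N}` of the leftmost `1` of `x`. -/
def leftmostOne {N : ℕ} (x : Fin N → Bool) : ℕ :=
  sInf {k | ∃ i : Fin N, k = (i : ℕ) + 1 ∧ x i = true}

open Classical in
/-- The adversary matrix `Γ^search`. -/
def searchMatrix (N : ℕ) : Matrix (Fin N → Bool) (Fin N → Bool) ℝ :=
  fun x y =>
    if x ∈ validInputs N ∧ y ∈ validInputs N ∧ x ≠ y then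
      1 / |(leftmostOne x : ℝ) - (leftmostOne y : ℝ)|
    else 0

/-! ### The infinite Hilbert matrix -/

/-- `H` is the bounded operator on `ℓ²` whose matrix in the standard basis is the infinite Hilbert
matrix `[1 / (r + s - 1)]_{r, s ≥ 1}`; the indices are shifted to start from `0`. -/
def IsHilbertOperator
    (H : lp (fun _ : ℕ => ℝ) 2 →L[ℝ] lp (fun _ : ℕ => ℝ) 2) : Prop :=
  ∀ r s : ℕ, (H (lp.single 2 s (1 : ℝ)) : ℕ → ℝ) r =
    1 / (((r + 1 : ℕ) : ℝ) + ((s + 1 : ℕ) : ℝ) - 1)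

end

end OrderedSearch

/-! A valid input is determined by the position of its leftmost `1`, so `Γ` is essentially the
Toeplitz matrix `1/|j - k|` on `N` indices. Two valid inputs differ in bit `i` exactly when their
positions lie on opposite sides of the cut after `i`. Counting positions away from the cut turns
`Γ_i` into a symmetric matrix whose off-diagonal block is a corner of the Hilbert matrix `1/(r+s+1)`
(`specNorm_queryMatrix_distMatrix`). All matrices involved are symmetric with non-negative entries,
so their norms can be read off the quadratic form on non-negative vectors (`specNorm_le`).

The constant `π` comes from Hilbert's inequality in its sharper form with denominators `r + s + 1/2`
(`hilbert_inequality_half`); the vectors `1/√r` show that `π` is also a lower bound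
(`sum_hilbert_ge`). The maximum over `i` is at the balanced cut because moving one index from the
longer side to the shorter one cannot lower the norm (`specNorm_bipHankel_succ_le`): the smallest
relevant coordinate of the singular pair is transplanted, and positivity of the Hilbert matrix
controls the new row.

The query bound is the adversary argument (`adversary_bound`): a weighted sum of overlaps starts at
the quadratic form of the matrix, must shrink to an `ε'` fraction of it, and drops by at most `2 max
λ(Γ_i)` times the squared norm of the weights per query. With `Γ` itself the constant test vector
gives only `2(H_N - 1)`, which is below `2 ln N` for `N ≥ 2`. The bound is therefore proved with the
larger kernel `1/(d - 1/2)`: the sharper Hilbert inequality still bounds its query matrices by `π`,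
and the constant vector now gives at least `2 ln N`. -/

namespace OrderedSearch

noncomputable section

/-! ### The spectral norm of symmetric matrices with non-negative entries -/

section SpecNorm

variable {ι κ : Type} [Fintype ι] [Fintype κ]

/-- The quadratic form of a square matrix. -/
def quadForm (M : Matrix ι ι ℝ) (u : ι → ℝ) : ℝ := ∑ i, ∑ j, M i j * (u i * u j)

lemma quadForm_eq_dotProduct (M : Matrix ι ι ℝ) (u : ι → ℝ) :
    quadForm M u = u ⬝ᵥ M.mulVec u := by
  simp only [quadForm, dotProduct, Matrix.mulVec, Finset.mul_sum]
  exact Finset.sum_congr rfl fun i _ => Finset.sum_congr rfl fun j _ => by ring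

lemma abs_quadForm_le {M : Matrix ι ι ℝ} (hM : ∀ i j, 0 ≤ M i j) (u : ι → ℝ) :
    |quadForm M u| ≤ quadForm M (fun i => |u i|) := by
  refine (Finset.abs_sum_le_sum_abs _ _).trans (Finset.sum_le_sum fun i _ => ?_)
  refine (Finset.abs_sum_le_sum_abs _ _).trans (Finset.sum_le_sum fun j _ => ?_)
  rw [abs_mul, abs_mul, abs_of_nonneg (hM i j)]

lemma sum_eq_sum_of_injective {A : Type*} [AddCommMonoid A] {e : κ → ι}
    (he : Function.Injective e) (f : ι → A) (hf : ∀ i, i ∉ Set.range e → f i = 0) :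
    ∑ i, f i = ∑ k, f (e k) := by
  classical
  rw [← Finset.sum_image (f := f) (s := Finset.univ) (g := e) he.injOn]
  symm
  refine Finset.sum_subset (Finset.subset_univ _) fun i _ hi => hf i ?_
  simpa using hi

lemma quadForm_submatrix {e : κ → ι} (he : Function.Injective e) {M : Matrix ι ι ℝ}
    (h0 : ∀ i j, i ∉ Set.range e ∨ j ∉ Set.range e → M i j = 0) (u : ι → ℝ) :
    quadForm M u = quadForm (M.submatrix e e) (u ∘ e) := by
  unfold quadForm
  rw [sum_eq_sum_of_injective he]
  · refine Finset.sum_congr rfl fun k _ => ?_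
    rw [sum_eq_sum_of_injective he]
    · rfl
    · intro j hj
      simp [h0 _ j (Or.inr hj)]
  · intro i hi
    exact Finset.sum_eq_zero fun j _ => by simp [h0 i j (Or.inl hi)]

variable [DecidableEq ι] [DecidableEq κ]

lemma quadForm_eq_inner (M : Matrix ι ι ℝ) (u : EuclideanSpace ℝ ι) :
    quadForm M u = inner ℝ (Matrix.toEuclideanCLM (n := ι) (𝕜 := ℝ) M u) u := by
  rw [real_inner_comm, Matrix.inner_toEuclideanCLM, quadForm_eq_dotProduct]

lemma specNorm_nonneg (M : Matrix ι ι ℝ) : 0 ≤ specNorm M := norm_nonneg _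

lemma quadForm_le_specNorm (M : Matrix ι ι ℝ) (u : ι → ℝ) :
    quadForm M u ≤ specNorm M * ∑ i, u i ^ 2 := by
  have h := quadForm_eq_inner M (WithLp.toLp 2 u)
  have h2 : ∑ i, u i ^ 2 = ‖WithLp.toLp 2 u‖ ^ 2 := by
    simp [EuclideanSpace.norm_sq_eq]
  rw [h2]
  calc quadForm M u = _ := h
    _ ≤ ‖Matrix.toEuclideanCLM (n := ι) (𝕜 := ℝ) M (WithLp.toLp 2 u)‖ * ‖WithLp.toLp 2 u‖ :=
      real_inner_le_norm _ _
    _ ≤ (specNorm M * ‖WithLp.toLp 2 u‖) * ‖WithLp.toLp 2 u‖ := by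
      gcongr
      exact ContinuousLinearMap.le_opNorm _ _
    _ = _ := by ring

lemma specNorm_le {M : Matrix ι ι ℝ} (hs : M.IsSymm) (hM : ∀ i j, 0 ≤ M i j) {c : ℝ} (hc : 0 ≤ c)
    (h : ∀ u : ι → ℝ, (∀ i, 0 ≤ u i) → quadForm M u ≤ c * ∑ i, u i ^ 2) : specNorm M ≤ c := by
  have hsymm : (Matrix.toEuclideanCLM (n := ι) (𝕜 := ℝ) M :
      EuclideanSpace ℝ ι →ₗ[ℝ] EuclideanSpace ℝ ι).IsSymmetric := by
    rw [Matrix.coe_toEuclideanCLM_eq_toEuclideanLin, Matrix.isSymmetric_toEuclideanLin_iff]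
    simpa [Matrix.IsHermitian] using hs.eq
  rw [specNorm, ContinuousLinearMap.norm_eq_iSup_rayleighQuotient _ hsymm]
  refine ciSup_le fun u => ?_
  rw [ContinuousLinearMap.rayleighQuotient, ContinuousLinearMap.reApplyInnerSelf_apply, abs_div,
    abs_of_nonneg (sq_nonneg ‖u‖)]
  refine div_le_of_le_mul₀ (sq_nonneg _) hc ?_
  have h1 := h (fun i => |u i|) fun i => abs_nonneg _
  simp only [RCLike.re_to_real, ← quadForm_eq_inner]
  refine (abs_quadForm_le hM _).trans (h1.trans_eq ?_)
  simp [EuclideanSpace.norm_sq_eq]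

/-- A non-negative Perron vector of a symmetric matrix with non-negative entries. -/
lemma exists_perron_vector [Nonempty ι] {M : Matrix ι ι ℝ} (hs : M.IsSymm)
    (hM : ∀ i j, 0 ≤ M i j) :
    ∃ u : ι → ℝ, (∀ i, 0 ≤ u i) ∧ 0 < ∑ i, u i ^ 2 ∧
      ∀ i, ∑ j, M i j * u j = specNorm M * u i := by
  set T := Matrix.toEuclideanCLM (n := ι) (𝕜 := ℝ) M with hT
  have hcont : Continuous fun u : EuclideanSpace ℝ ι => quadForm M u := by
    simp only [quadForm_eq_inner]
    fun_prop
  obtain ⟨u₀, hu₀, hmax⟩ := (isCompact_sphere (0 : EuclideanSpace ℝ ι) 1).exists_isMaxOn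
    (NormedSpace.sphere_nonempty.mpr zero_le_one) hcont.continuousOn
  have hn₀ : ∑ i, u₀ i ^ 2 = 1 := by
    have : ‖u₀‖ = 1 := by simpa using hu₀
    have h2 := EuclideanSpace.norm_sq_eq u₀
    rw [this] at h2
    simpa using h2.symm
  -- With non-negative entries, passing to absolute values keeps the norm and cannot lower the form,
  -- so `u` is again a maximizer.
  set u : ι → ℝ := fun i => |u₀ i| with hu
  have hun : ∑ i, u i ^ 2 = 1 := by simpa [hu] using hn₀
  have hq : specNorm M ≤ quadForm M u := by
    refine specNorm_le hs hM (Finset.sum_nonneg fun i _ => Finset.sum_nonneg fun j _ =>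
      mul_nonneg (hM i j) (mul_nonneg (abs_nonneg _) (abs_nonneg _))) fun v _ => ?_
    rcases eq_or_ne (∑ i, v i ^ 2) 0 with h0 | h0
    · have : ∀ i, v i = 0 := fun i => by
        simpa using (Finset.sum_eq_zero_iff_of_nonneg fun i _ => sq_nonneg (v i)).1 h0 i
          (Finset.mem_univ i)
      simp [quadForm, this]
    have hpos : 0 < ∑ i, v i ^ 2 := lt_of_le_of_ne (Finset.sum_nonneg fun i _ => sq_nonneg _) h0.symm
    set r := Real.sqrt (∑ i, v i ^ 2) with hr
    have hr2 : r ^ 2 = ∑ i, v i ^ 2 := Real.sq_sqrt hpos.le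
    have hrp : 0 < r := Real.sqrt_pos.2 hpos
    have hmem : WithLp.toLp 2 (fun i => v i / r) ∈ Metric.sphere (0 : EuclideanSpace ℝ ι) 1 := by
      rw [mem_sphere_zero_iff_norm, ← sq_eq_sq₀ (norm_nonneg _) zero_le_one,
        EuclideanSpace.norm_sq_eq]
      simp only [Real.norm_eq_abs, sq_abs, div_pow, ← Finset.sum_div, hr2]
      simp [h0]
    have h1 : quadForm M (fun i => v i / r) ≤ quadForm M u₀ := hmax hmem
    have h2 : quadForm M (fun i => v i / r) = quadForm M v / r ^ 2 := by
      simp only [quadForm, Finset.sum_div]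
      exact Finset.sum_congr rfl fun i _ => Finset.sum_congr rfl fun j _ => by ring
    rw [← hr2, ← div_le_iff₀ (by positivity), ← h2]
    exact h1.trans ((le_abs_self _).trans (abs_quadForm_le hM _))
  have hq' : quadForm M u = specNorm M := le_antisymm (by
    simpa [hun] using quadForm_le_specNorm M u) hq
  refine ⟨u, fun i => abs_nonneg _, by rw [hun]; exact one_pos, ?_⟩
  set w : EuclideanSpace ℝ ι := WithLp.toLp 2 u with hw
  have hwn : ‖w‖ = 1 := by
    rw [← sq_eq_sq₀ (norm_nonneg _) zero_le_one, EuclideanSpace.norm_sq_eq]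
    simpa [hw] using hun
  have hTw : ‖T w‖ ≤ specNorm M := by
    have := T.le_opNorm w
    rwa [hwn, mul_one] at this
  have hin : inner ℝ (T w) w = specNorm M := by
    rw [← hq', hw, quadForm_eq_inner M (WithLp.toLp 2 u)]
  -- The expansion is `‖T w‖² - 2λ² + λ²` with `‖T w‖ ≤ λ`: a unit vector attaining the norm in the
  -- form is an eigenvector.
  have hzero : ‖T w - specNorm M • w‖ ^ 2 ≤ 0 := by
    rw [norm_sub_sq_real, inner_smul_right, hin, norm_smul, hwn, Real.norm_eq_abs, mul_one, sq_abs]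
    nlinarith [norm_nonneg (T w), specNorm_nonneg M]
  have hz : T w = specNorm M • w := by
    rw [← sub_eq_zero, ← norm_eq_zero]
    exact pow_eq_zero_iff two_ne_zero |>.1 (le_antisymm hzero (sq_nonneg _))
  intro i
  have := congrArg (fun v : EuclideanSpace ℝ ι => v i) hz
  simpa [hT, hw, Matrix.mulVec, dotProduct] using this

lemma specNorm_submatrix {e : κ → ι} (he : Function.Injective e) {M : Matrix ι ι ℝ}
    (hs : M.IsSymm) (hM : ∀ i j, 0 ≤ M i j)
    (h0 : ∀ i j, i ∉ Set.range e ∨ j ∉ Set.range e → M i j = 0) :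
    specNorm (M.submatrix e e) = specNorm M := by
  apply le_antisymm
  · refine specNorm_le (hs.submatrix e) (fun _ _ => hM _ _) (specNorm_nonneg _) fun v hv => ?_
    have h1 := quadForm_le_specNorm M (Function.extend e v 0)
    have h2 : Function.extend e v 0 ∘ e = v := funext fun k => he.extend_apply v 0 k
    rw [quadForm_submatrix he h0, h2, sum_eq_sum_of_injective he] at h1
    · simpa [he.extend_apply] using h1
    · intro i hi
      rw [Function.extend_apply' _ _ _ (by simpa using hi)]
      simp
  · refine specNorm_le hs hM (specNorm_nonneg _) fun u hu => ?_
    rw [quadForm_submatrix he h0]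
    refine (quadForm_le_specNorm _ _).trans ?_
    refine mul_le_mul_of_nonneg_left ?_ (specNorm_nonneg _)
    simp only [Function.comp_apply]
    rw [← Finset.sum_image (f := fun i => u i ^ 2) (s := Finset.univ) (g := e) he.injOn]
    exact Finset.sum_le_sum_of_subset_of_nonneg (Finset.subset_univ _) fun i _ _ => sq_nonneg _

end SpecNorm

/-! ### Hilbert's inequality -/

-- At half-integer frequency the exponential is `-1` at `2π` and `1` at `0`, so the boundary terms
-- add up and produce the entries of the Hilbert-type matrix as an integral.
open Complex in
lemma integral_cexp_half_integer (n : ℕ) :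
    ∫ θ in (0 : ℝ)..2 * Real.pi, cexp ((((n : ℂ) + 1 / 2) * I) * θ) =
      2 * I * (1 / ((n : ℂ) + 1 / 2)) := by
  have hn : ((n : ℂ) + 1 / 2) ≠ 0 := by
    have : ((n : ℂ) + 1 / 2) = (((n : ℝ) + 1 / 2 : ℝ) : ℂ) := by push_cast; ring
    rw [this, Complex.ofReal_ne_zero]
    positivity
  rw [integral_exp_mul_complex (mul_ne_zero hn I_ne_zero)]
  have h1 : cexp ((((n : ℂ) + 1 / 2) * I) * ((2 * Real.pi : ℝ) : ℂ)) = -1 := by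
    have : (((n : ℂ) + 1 / 2) * I) * ((2 * Real.pi : ℝ) : ℂ)
        = n * (2 * Real.pi * I) + Real.pi * I := by push_cast; ring
    rw [this, Complex.exp_add, Complex.exp_nat_mul_two_pi_mul_I, Complex.exp_pi_mul_I]
    ring
  rw [h1]
  simp only [ofReal_zero, mul_zero, Complex.exp_zero]
  field_simp
  rw [Complex.I_sq]
  ring

open Complex in
lemma integral_cexp_int (n : ℤ) :
    ∫ θ in (0 : ℝ)..2 * Real.pi, cexp (((n : ℂ) * I) * θ) = if n = 0 then 2 * Real.pi else 0 := by
  split_ifs with h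
  · simp [h]
  · have hn : (n : ℂ) ≠ 0 := by exact_mod_cast h
    rw [integral_exp_mul_complex (mul_ne_zero hn I_ne_zero)]
    have h1 : cexp (((n : ℂ) * I) * ((2 * Real.pi : ℝ) : ℂ)) = 1 := by
      have : ((n : ℂ) * I) * ((2 * Real.pi : ℝ) : ℂ) = n * (2 * Real.pi * I) := by push_cast; ring
      rw [this, Complex.exp_int_mul_two_pi_mul_I]
    rw [h1]
    simp

/-- A trigonometric polynomial with real coefficients. -/
def trigPoly (s : Finset ℕ) (x : ℕ → ℝ) (θ : ℝ) : ℂ :=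
  ∑ r ∈ s, (x r : ℂ) * Complex.exp (((r : ℂ) * Complex.I) * θ)

lemma continuous_trigPoly (s : Finset ℕ) (x : ℕ → ℝ) : Continuous (trigPoly s x) := by
  unfold trigPoly
  fun_prop

open Complex in
lemma integral_norm_sq_trigPoly (s : Finset ℕ) (x : ℕ → ℝ) :
    ∫ θ in (0 : ℝ)..2 * Real.pi, ‖trigPoly s x θ‖ ^ 2 = 2 * Real.pi * ∑ r ∈ s, x r ^ 2 := by
  apply Complex.ofReal_injective
  rw [← intervalIntegral.integral_ofReal]
  have h1 : ∀ θ : ℝ, ((‖trigPoly s x θ‖ ^ 2 : ℝ) : ℂ) =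
      ∑ r ∈ s, ∑ k ∈ s, ((x r * x k : ℝ) : ℂ) * cexp ((((r : ℤ) - (k : ℤ) : ℤ) : ℂ) * I * θ) := by
    intro θ
    rw [ofReal_pow, ← Complex.mul_conj', trigPoly, map_sum, Finset.sum_mul_sum]
    refine Finset.sum_congr rfl fun r _ => Finset.sum_congr rfl fun k _ => ?_
    rw [map_mul, conj_ofReal, ← Complex.exp_conj, mul_mul_mul_comm, ← Complex.exp_add]
    push_cast
    simp only [map_mul, conj_ofReal, conj_I, map_natCast]
    congr 2
    ring
  simp only [h1]
  rw [intervalIntegral.integral_finsetSum fun r _ =>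
    Continuous.intervalIntegrable (by fun_prop) _ _]
  push_cast
  rw [Finset.mul_sum]
  refine Finset.sum_congr rfl fun r hr => ?_
  rw [intervalIntegral.integral_finsetSum fun r _ =>
    Continuous.intervalIntegrable (by fun_prop) _ _]
  rw [Finset.sum_eq_single r]
  · rw [intervalIntegral.integral_const_mul]
    have := integral_cexp_int 0
    simp only [Int.cast_zero, if_true] at this
    simp only [sub_self]
    rw [this]
    push_cast
    ring
  · intro k _ hk
    rw [intervalIntegral.integral_const_mul]
    have := integral_cexp_int ((r : ℤ) - k)
    rw [if_neg (by omega)] at this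
    push_cast at this
    rw [this, mul_zero]
  · exact fun h => absurd hr h

open Complex in
/-- Hilbert's inequality for the matrix `[1 / (r + s + 1/2)]`. -/
theorem hilbert_inequality_half (s t : Finset ℕ) (x y : ℕ → ℝ) :
    ∑ r ∈ s, ∑ k ∈ t, x r * y k * (1 / ((r : ℝ) + k + 1 / 2)) ≤
      Real.pi / 2 * (∑ r ∈ s, x r ^ 2 + ∑ k ∈ t, y k ^ 2) := by
  set B := ∑ r ∈ s, ∑ k ∈ t, x r * y k * (1 / ((r : ℝ) + k + 1 / 2)) with hB
  -- The extra factor `e^{iθ/2}` has modulus one and shifts the frequency `r + k` to `r + k + 1/2`;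
  -- the bilinear form becomes an integral that AM-GM and Parseval control.
  have h1 : ∫ θ in (0 : ℝ)..2 * Real.pi,
      trigPoly s x θ * trigPoly t y θ * cexp ((1 / 2 * I) * θ) = 2 * I * (B : ℂ) := by
    have h2 : ∀ θ : ℝ, trigPoly s x θ * trigPoly t y θ * cexp ((1 / 2 * I) * θ) =
        ∑ r ∈ s, ∑ k ∈ t, ((x r * y k : ℝ) : ℂ) * cexp (((((r + k : ℕ) : ℂ) + 1 / 2) * I) * θ) := by
      intro θ
      rw [trigPoly, trigPoly, Finset.sum_mul_sum, Finset.sum_mul]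
      refine Finset.sum_congr rfl fun r _ => ?_
      rw [Finset.sum_mul]
      refine Finset.sum_congr rfl fun k _ => ?_
      rw [mul_mul_mul_comm, mul_assoc, ← Complex.exp_add, ← Complex.exp_add, ofReal_mul]
      congr 2
      push_cast
      ring
    simp only [h2]
    rw [intervalIntegral.integral_finsetSum fun r _ =>
      Continuous.intervalIntegrable (by fun_prop) _ _, hB]
    push_cast
    rw [Finset.mul_sum]
    refine Finset.sum_congr rfl fun r _ => ?_
    rw [intervalIntegral.integral_finsetSum fun r _ =>
      Continuous.intervalIntegrable (by fun_prop) _ _, Finset.mul_sum]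
    refine Finset.sum_congr rfl fun k _ => ?_
    have := integral_cexp_half_integer (r + k)
    push_cast at this
    rw [intervalIntegral.integral_const_mul, this]
    ring
  have h3 : 2 * B ≤ ‖∫ θ in (0 : ℝ)..2 * Real.pi,
      trigPoly s x θ * trigPoly t y θ * cexp ((1 / 2 * I) * θ)‖ := by
    rw [h1]
    simpa using le_abs_self B
  have hc1 := continuous_trigPoly s x
  have hc2 := continuous_trigPoly t y
  have h4 : ‖∫ θ in (0 : ℝ)..2 * Real.pi,
      trigPoly s x θ * trigPoly t y θ * cexp ((1 / 2 * I) * θ)‖ ≤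
      ∫ θ in (0 : ℝ)..2 * Real.pi,
        ((1 / 2) * ‖trigPoly s x θ‖ ^ 2 + (1 / 2) * ‖trigPoly t y θ‖ ^ 2) := by
    refine (intervalIntegral.norm_integral_le_integral_norm Real.two_pi_pos.le).trans ?_
    refine intervalIntegral.integral_mono_on Real.two_pi_pos.le
      (Continuous.intervalIntegrable (by fun_prop) _ _)
      (Continuous.intervalIntegrable (by fun_prop) _ _) fun θ _ => ?_
    have he : ‖cexp ((1 / 2 * I) * θ)‖ = 1 := by
      rw [show (1 / 2 * I) * (θ : ℂ) = ((θ / 2 : ℝ) : ℂ) * I by push_cast; ring,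
        Complex.norm_exp_ofReal_mul_I]
    rw [norm_mul, norm_mul, he]
    nlinarith [sq_nonneg (‖trigPoly s x θ‖ - ‖trigPoly t y θ‖)]
  rw [intervalIntegral.integral_add (Continuous.intervalIntegrable (by fun_prop) _ _)
    (Continuous.intervalIntegrable (by fun_prop) _ _), intervalIntegral.integral_const_mul,
    intervalIntegral.integral_const_mul, integral_norm_sq_trigPoly, integral_norm_sq_trigPoly] at h4
  linarith

lemma hilbert_inequality (s t : Finset ℕ) {x y : ℕ → ℝ} (hx : ∀ r, 0 ≤ x r) (hy : ∀ r, 0 ≤ y r) :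
    ∑ r ∈ s, ∑ k ∈ t, x r * y k * (1 / ((r : ℝ) + k + 1)) ≤
      Real.pi / 2 * (∑ r ∈ s, x r ^ 2 + ∑ k ∈ t, y k ^ 2) := by
  refine le_trans ?_ (hilbert_inequality_half s t x y)
  refine Finset.sum_le_sum fun r _ => Finset.sum_le_sum fun k _ => ?_
  refine mul_le_mul_of_nonneg_left ?_ (mul_nonneg (hx r) (hy k))
  exact one_div_le_one_div_of_le (by positivity) (by linarith)

/-! ### The norm of the infinite Hilbert matrix -/

/-- Duality: Hilbert's bilinear inequality is tested on the image sequence itself, after passing to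
absolute values. -/
lemma sum_sq_hilbert_le (R S : Finset ℕ) (x : ℕ → ℝ) :
    ∑ r ∈ R, (∑ s ∈ S, x s * (1 / ((r : ℝ) + s + 1))) ^ 2 ≤ Real.pi ^ 2 * ∑ s ∈ S, x s ^ 2 := by
  set a : ℕ → ℝ := fun r => ∑ s ∈ S, |x s| * (1 / ((r : ℝ) + s + 1)) with ha
  have ha0 : ∀ r, 0 ≤ a r := fun r => Finset.sum_nonneg fun s _ => by positivity
  have h1 : ∑ r ∈ R, (∑ s ∈ S, x s * (1 / ((r : ℝ) + s + 1))) ^ 2 ≤ ∑ r ∈ R, a r ^ 2 := by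
    refine Finset.sum_le_sum fun r _ => sq_le_sq' ?_ ?_
    · refine neg_le_of_abs_le ((Finset.abs_sum_le_sum_abs _ _).trans (Finset.sum_le_sum fun s _ => ?_))
      rw [abs_mul, abs_of_nonneg (by positivity : (0 : ℝ) ≤ 1 / ((r : ℝ) + s + 1))]
    · exact Finset.sum_le_sum fun s _ =>
        mul_le_mul_of_nonneg_right (le_abs_self _) (by positivity)
  refine h1.trans ?_
  have hpi := Real.pi_pos
  -- Dividing the image by `π` balances the two sums of squares, so that no constant is lost against
  -- the product form of the inequality.
  have h2 := hilbert_inequality R S (x := fun r => a r / Real.pi) (y := fun s => |x s|)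
    (fun r => div_nonneg (ha0 r) hpi.le) (fun s => abs_nonneg _)
  have h3 : ∑ r ∈ R, ∑ s ∈ S, a r / Real.pi * |x s| * (1 / ((r : ℝ) + s + 1)) =
      (∑ r ∈ R, a r ^ 2) / Real.pi := by
    rw [Finset.sum_div]
    refine Finset.sum_congr rfl fun r _ => ?_
    rw [sq, mul_div_right_comm, show a r / Real.pi * a r = a r / Real.pi *
      ∑ s ∈ S, |x s| * (1 / ((r : ℝ) + s + 1)) from rfl, Finset.mul_sum]
    exact Finset.sum_congr rfl fun s _ => by ring
  simp only [div_pow, sq_abs, ← Finset.sum_div] at h2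
  rw [h3] at h2
  set A := ∑ r ∈ R, a r ^ 2
  set X := ∑ s ∈ S, x s ^ 2
  have h4 : A / Real.pi = Real.pi * (A / Real.pi ^ 2) := by field_simp
  rw [h4] at h2
  have h5 : A / Real.pi ^ 2 ≤ X := by
    by_contra h
    push Not at h
    nlinarith
  rwa [div_le_iff₀' (by positivity)] at h5

lemma lp_two_summable_sq (x : lp (fun _ : ℕ => ℝ) 2) : Summable fun s => (x s) ^ 2 := by
  have := (lp.memℓp x).summable (by norm_num)
  simpa using this

lemma lp_two_norm_sq (x : lp (fun _ : ℕ => ℝ) 2) : ‖x‖ ^ 2 = ∑' s, (x s) ^ 2 := by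
  have := lp.norm_rpow_eq_tsum (p := 2) (by norm_num) x
  simpa using this

lemma summable_mul_hilbert (x : lp (fun _ : ℕ => ℝ) 2) (r : ℕ) :
    Summable fun s : ℕ => x s * (1 / ((r : ℝ) + s + 1)) := by
  have h1 : Summable fun s : ℕ => 1 / (((s + 1 : ℕ) : ℝ)) ^ 2 :=
    (summable_nat_add_iff 1).2 (Real.summable_one_div_nat_pow.2 one_lt_two)
  refine Summable.of_norm_bounded ((lp_two_summable_sq x).add h1) fun s => ?_
  have h2 : (1 : ℝ) / ((r : ℝ) + s + 1) ≤ 1 / (((s + 1 : ℕ) : ℝ)) := by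
    refine one_div_le_one_div_of_le (by positivity) ?_
    push_cast
    linarith [(Nat.cast_nonneg r : (0 : ℝ) ≤ r)]
  have h3 : (0 : ℝ) < 1 / ((r : ℝ) + s + 1) := by positivity
  rw [Real.norm_eq_abs, abs_mul, abs_of_pos h3, ← one_div_pow]
  nlinarith [abs_nonneg (x s), sq_abs (x s), sq_nonneg (|x s| - 1 / (((s + 1 : ℕ) : ℝ)))]

/-- The image of a square-summable sequence under the infinite Hilbert matrix. -/
def hilbertSeq (x : lp (fun _ : ℕ => ℝ) 2) (r : ℕ) : ℝ := ∑' s : ℕ, x s * (1 / ((r : ℝ) + s + 1))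

lemma sum_sq_hilbertSeq_le (x : lp (fun _ : ℕ => ℝ) 2) (R : Finset ℕ) :
    ∑ r ∈ R, hilbertSeq x r ^ 2 ≤ (Real.pi * ‖x‖) ^ 2 := by
  have hlim : Filter.Tendsto
      (fun S : Finset ℕ => ∑ r ∈ R, (∑ s ∈ S, x s * (1 / ((r : ℝ) + s + 1))) ^ 2) Filter.atTop
      (nhds (∑ r ∈ R, hilbertSeq x r ^ 2)) :=
    tendsto_finsetSum _ fun r _ => ((summable_mul_hilbert x r).hasSum).pow 2
  refine le_of_tendsto hlim (Filter.Eventually.of_forall fun S => ?_)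
  refine (sum_sq_hilbert_le R S x).trans ?_
  rw [mul_pow, lp_two_norm_sq]
  exact mul_le_mul_of_nonneg_left
    ((lp_two_summable_sq x).sum_le_tsum S fun s _ => sq_nonneg _) (sq_nonneg _)

lemma memℓp_hilbertSeq (x : lp (fun _ : ℕ => ℝ) 2) : Memℓp (hilbertSeq x) 2 :=
  memℓp_gen' (C := (Real.pi * ‖x‖) ^ 2) fun R => by
    simpa using sum_sq_hilbertSeq_le x R

/-- The bounded operator on `ℓ²` given by the infinite Hilbert matrix. -/
def hilbertOperator : lp (fun _ : ℕ => ℝ) 2 →L[ℝ] lp (fun _ : ℕ => ℝ) 2 :=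
  LinearMap.mkContinuous
    { toFun := fun x => ⟨hilbertSeq x, memℓp_hilbertSeq x⟩
      map_add' := fun x y => by
        ext r
        change hilbertSeq (x + y) r = hilbertSeq x r + hilbertSeq y r
        rw [hilbertSeq, hilbertSeq, hilbertSeq,
          ← (summable_mul_hilbert x r).tsum_add (summable_mul_hilbert y r)]
        exact tsum_congr fun s => add_mul _ _ _
      map_smul' := fun c x => by
        ext r
        change hilbertSeq (c • x) r = c * hilbertSeq x r
        rw [hilbertSeq, hilbertSeq, ← tsum_mul_left]
        exact tsum_congr fun s => mul_assoc _ _ _ }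
    Real.pi fun x => by
      refine lp.norm_le_of_forall_sum_le (by norm_num) (by positivity) fun R => ?_
      simpa using sum_sq_hilbertSeq_le x R

lemma norm_hilbertOperator_le : ‖hilbertOperator‖ ≤ Real.pi :=
  LinearMap.mkContinuous_norm_le _ Real.pi_pos.le _

lemma isHilbertOperator_hilbertOperator : IsHilbertOperator hilbertOperator := by
  intro r s
  change hilbertSeq (lp.single 2 s (1 : ℝ)) r = _
  rw [hilbertSeq, tsum_eq_single s]
  · rw [lp.single_apply_self]
    push_cast
    rw [one_mul]
    congr 1
    ring
  · intro k hk
    rw [lp.single_apply_ne _ _ _ hk, zero_mul]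

/-! ### The lower bound `π` for the norm. -/

lemma arctan_sub_arctan_le {a b : ℝ} (hb : 0 ≤ b) (hab : b ≤ a) :
    Real.arctan a - Real.arctan b ≤ (a - b) / (1 + b ^ 2) := by
  have := (convex_Ici b).image_sub_le_mul_sub_of_deriv_le (f := Real.arctan) (C := 1 / (1 + b ^ 2))
    Real.continuous_arctan.continuousOn Real.differentiable_arctan.differentiableOn
    (fun x hx => by
      rw [interior_Ici] at hx
      rw [Real.deriv_arctan]
      exact one_div_le_one_div_of_le (by positivity) (by
        have : b < x := hx
        nlinarith)) b (by simp) a hab hab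
  rw [div_eq_mul_one_div, mul_comm]
  exact this

lemma arctan_le_self {x : ℝ} (hx : 0 ≤ x) : Real.arctan x ≤ x := by
  simpa using arctan_sub_arctan_le le_rfl hx

lemma sqrt_succ_sub_sqrt_le {k : ℝ} (hk : 0 < k) :
    Real.sqrt (k + 1) - Real.sqrt k ≤ 1 / (2 * Real.sqrt k) := by
  have h1 := Real.sq_sqrt hk.le
  have h2 := Real.sq_sqrt (by linarith : (0 : ℝ) ≤ k + 1)
  have h3 := Real.sqrt_pos.2 hk
  rw [le_div_iff₀ (by positivity)]
  nlinarith [sq_nonneg (Real.sqrt (k + 1) - Real.sqrt k)]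

/-- The left side is the integral of the decreasing function `1/((j + x)√x)` over `[1, n + 1]`, with
antiderivative `(2/√j) arctan √(x/j)`; each term of the sum dominates one unit interval. -/
lemma arctan_sqrt_telescope {j : ℝ} (hj : 0 < j) (n : ℕ) :
    2 / Real.sqrt j *
        (Real.arctan (Real.sqrt (n + 1) / Real.sqrt j) - Real.arctan (1 / Real.sqrt j)) ≤
      ∑ k ∈ Finset.range n, 1 / ((j + (k + 1)) * Real.sqrt (k + 1)) := by
  have hsj := Real.sqrt_pos.2 hj
  have hj2 := Real.sq_sqrt hj.le
  induction n with
  | zero => simp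
  | succ n ih =>
    rw [Finset.sum_range_succ]
    set k : ℝ := (n : ℝ) + 1 with hk
    have hk0 : 0 < k := by positivity
    push_cast
    rw [← hk]
    have h1 := arctan_sub_arctan_le (a := Real.sqrt (k + 1) / Real.sqrt j)
      (b := Real.sqrt k / Real.sqrt j) (by positivity)
      (div_le_div_of_nonneg_right (Real.sqrt_le_sqrt (by linarith)) hsj.le)
    have h2 : 2 / Real.sqrt j * ((Real.sqrt (k + 1) / Real.sqrt j - Real.sqrt k / Real.sqrt j) /
        (1 + (Real.sqrt k / Real.sqrt j) ^ 2)) =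
        2 * (Real.sqrt (k + 1) - Real.sqrt k) / (j + k) := by
      rw [div_pow, hj2, Real.sq_sqrt hk0.le]
      have : Real.sqrt j * Real.sqrt j = j := Real.mul_self_sqrt hj.le
      field_simp
      rw [hj2]
      ring
    have h3 : 2 * (Real.sqrt (k + 1) - Real.sqrt k) / (j + k) ≤ 1 / ((j + k) * Real.sqrt k) := by
      have h4 := sqrt_succ_sub_sqrt_le hk0
      have h5 := Real.sqrt_pos.2 hk0
      rw [mul_comm (j + k), ← div_div]
      refine div_le_div_of_nonneg_right ?_ (by positivity)
      calc 2 * (Real.sqrt (k + 1) - Real.sqrt k) ≤ 2 * (1 / (2 * Real.sqrt k)) := by linarith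
        _ = 1 / Real.sqrt k := by field_simp
    have h6 := mul_le_mul_of_nonneg_left h1 (by positivity : 0 ≤ 2 / Real.sqrt j)
    rw [h2] at h6
    rw [mul_sub] at h6 ih ⊢
    linarith

/-- `π/√j` is the integral over `(0, ∞)`; the two corrections pay for the tail beyond `n + 1` and
for the piece `(0, 1)`. -/
lemma sum_inv_mul_sqrt_ge {j : ℝ} (hj : 0 < j) (n : ℕ) :
    Real.pi / Real.sqrt j - 2 / Real.sqrt (n + 1) - 2 / j ≤
      ∑ k ∈ Finset.range n, 1 / ((j + (k + 1)) * Real.sqrt (k + 1)) := by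
  refine le_trans ?_ (arctan_sqrt_telescope hj n)
  have hsj := Real.sqrt_pos.2 hj
  have hsn : 0 < Real.sqrt ((n : ℝ) + 1) := Real.sqrt_pos.2 (by positivity)
  have h1 : Real.pi / 2 - Real.sqrt j / Real.sqrt (n + 1) ≤
      Real.arctan (Real.sqrt (n + 1) / Real.sqrt j) := by
    have h2 := Real.arctan_inv_of_pos (x := Real.sqrt j / Real.sqrt (n + 1)) (by positivity)
    rw [inv_div] at h2
    rw [h2]
    have := arctan_le_self (x := Real.sqrt j / Real.sqrt (n + 1)) (by positivity)
    linarith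
  have h3 := arctan_le_self (x := 1 / Real.sqrt j) (by positivity)
  calc Real.pi / Real.sqrt j - 2 / Real.sqrt (n + 1) - 2 / j
      = 2 / Real.sqrt j * (Real.pi / 2 - Real.sqrt j / Real.sqrt (n + 1) - 1 / Real.sqrt j) := by
        have h4 : 2 / j = 2 / Real.sqrt j * (1 / Real.sqrt j) := by
          rw [div_mul_div_comm, mul_one, Real.mul_self_sqrt hj.le]
        have h5 : 2 / Real.sqrt (n + 1) =
            2 / Real.sqrt j * (Real.sqrt j / Real.sqrt ((n : ℝ) + 1)) := by
          field_simp
        rw [h4, h5]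
        ring
    _ ≤ _ := by
        refine mul_le_mul_of_nonneg_left ?_ (by positivity)
        linarith

lemma sum_inv_sqrt_le (n : ℕ) :
    ∑ j ∈ Finset.range n, 1 / Real.sqrt (j + 1) ≤ 2 * Real.sqrt n := by
  induction n with
  | zero => simp
  | succ n ih =>
    rw [Finset.sum_range_succ]
    have h1 := Real.sq_sqrt (by positivity : (0 : ℝ) ≤ n)
    have h2 := Real.sq_sqrt (by positivity : (0 : ℝ) ≤ (n : ℝ) + 1)
    have h3 : 0 < Real.sqrt ((n : ℝ) + 1) := Real.sqrt_pos.2 (by positivity)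
    push_cast
    have h4 : 1 / Real.sqrt ((n : ℝ) + 1) ≤ 2 * (Real.sqrt ((n : ℝ) + 1) - Real.sqrt n) := by
      rw [div_le_iff₀ h3]
      nlinarith [sq_nonneg (Real.sqrt ((n : ℝ) + 1) - Real.sqrt n)]
    linarith

lemma sum_inv_mul_sqrt_le (n : ℕ) :
    ∑ j ∈ Finset.range n, 1 / (((j : ℝ) + 1) * Real.sqrt (j + 1)) ≤
      4 - 4 / Real.sqrt (n + 1) := by
  induction n with
  | zero => norm_num
  | succ n ih =>
    rw [Finset.sum_range_succ]
    push_cast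
    set k : ℝ := (n : ℝ) + 1 with hk
    have hk1 : 1 ≤ k := by rw [hk]; linarith [(Nat.cast_nonneg n : (0 : ℝ) ≤ n)]
    have h1 := Real.sq_sqrt (by positivity : (0 : ℝ) ≤ k)
    have h2 := Real.sq_sqrt (by positivity : (0 : ℝ) ≤ k + 1)
    have h3 : 0 < Real.sqrt k := Real.sqrt_pos.2 (by positivity)
    have h4 : Real.sqrt k ≤ Real.sqrt (k + 1) := Real.sqrt_le_sqrt (by linarith)
    set a := Real.sqrt k
    set b := Real.sqrt (k + 1)
    have h5 : 1 / (2 * b) ≤ b - a := by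
      rw [div_le_iff₀ (by linarith)]
      nlinarith
    have h6 : b ≤ 4 * a ^ 2 * (b - a) := by
      refine le_trans ?_ (mul_le_mul_of_nonneg_left h5 (by positivity))
      rw [mul_one_div, le_div_iff₀ (by linarith)]
      nlinarith
    have h7 : 1 / (k * a) ≤ 4 / a - 4 / b := by
      rw [← h1, div_sub_div _ _ h3.ne' (by linarith), div_le_div_iff₀ (by positivity)
        (mul_pos h3 (by linarith))]
      nlinarith
    linarith

/-- The form of the Hilbert matrix at the vector `1/√(r+1)`, whose squared norm is a harmonic
number. The error `12` is `4` from the tails (`sum_inv_sqrt_le`) plus `2 · 4` from the pieces near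
zero (`sum_inv_mul_sqrt_le`). -/
lemma sum_hilbert_ge (n : ℕ) :
    Real.pi * ∑ r ∈ Finset.range n, 1 / ((r : ℝ) + 1) - 12 ≤
      ∑ r ∈ Finset.range n, ∑ s ∈ Finset.range n,
        1 / Real.sqrt (r + 1) * (1 / Real.sqrt (s + 1)) * (1 / ((r : ℝ) + s + 1)) := by
  have h1 : ∀ r ∈ Finset.range n,
      Real.pi * (1 / ((r : ℝ) + 1)) - 2 / Real.sqrt (n + 1) * (1 / Real.sqrt (r + 1)) -
        2 * (1 / (((r : ℝ) + 1) * Real.sqrt (r + 1))) ≤ ∑ s ∈ Finset.range n,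
        1 / Real.sqrt (r + 1) * (1 / Real.sqrt (s + 1)) * (1 / ((r : ℝ) + s + 1)) := by
    intro r _
    have hr : (0 : ℝ) < (r : ℝ) + 1 := by positivity
    have hsr := Real.sqrt_pos.2 hr
    have h2 := mul_le_mul_of_nonneg_left (sum_inv_mul_sqrt_ge hr n)
      (by positivity : 0 ≤ 1 / Real.sqrt ((r : ℝ) + 1))
    rw [Finset.mul_sum] at h2
    calc _ = 1 / Real.sqrt ((r : ℝ) + 1) *
          (Real.pi / Real.sqrt (r + 1) - 2 / Real.sqrt (n + 1) - 2 / ((r : ℝ) + 1)) := by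
          have : (r : ℝ) + 1 = Real.sqrt (r + 1) * Real.sqrt (r + 1) :=
            (Real.mul_self_sqrt hr.le).symm
          have hsn : 0 < Real.sqrt ((n : ℝ) + 1) := Real.sqrt_pos.2 (by positivity)
          set q := Real.sqrt ((r : ℝ) + 1)
          rw [this]
          field_simp
      _ ≤ _ := h2
      _ ≤ _ := by
          refine Finset.sum_le_sum fun s _ => ?_
          have hss : 0 < Real.sqrt ((s : ℝ) + 1) := Real.sqrt_pos.2 (by positivity)
          rw [mul_assoc]
          refine mul_le_mul_of_nonneg_left ?_ (by positivity)
          -- The row estimate has denominator `r + s + 2`, which exceeds `r + s + 1`; this only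
          -- weakens the lower bound.
          rw [mul_comm ((r : ℝ) + 1 + (s + 1)), one_div_mul_one_div]
          exact one_div_le_one_div_of_le (by positivity)
            (mul_le_mul_of_nonneg_left (by linarith) hss.le)
  refine le_trans ?_ (Finset.sum_le_sum h1)
  rw [Finset.sum_sub_distrib, Finset.sum_sub_distrib, ← Finset.mul_sum, ← Finset.mul_sum,
    ← Finset.mul_sum]
  have h2 := sum_inv_sqrt_le n
  have h3 := sum_inv_mul_sqrt_le n
  have hsn : 0 < Real.sqrt ((n : ℝ) + 1) := Real.sqrt_pos.2 (by positivity)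
  have h4 : 0 < 2 / Real.sqrt ((n : ℝ) + 1) := by positivity
  have h5 : 2 / Real.sqrt ((n : ℝ) + 1) * (2 * Real.sqrt n) ≤ 4 := by
    have : Real.sqrt n ≤ Real.sqrt ((n : ℝ) + 1) := Real.sqrt_le_sqrt (by linarith)
    rw [div_mul_eq_mul_div, div_le_iff₀ hsn]
    linarith
  have h6 := mul_le_mul_of_nonneg_left h2 h4.le
  have h7 : 4 / Real.sqrt ((n : ℝ) + 1) = 2 * (2 / Real.sqrt ((n : ℝ) + 1)) := by ring
  linarith

/-- The Rayleigh quotients at the truncations of `1/√(s+1)` are at least `π - 12/L n`, and the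
harmonic sums `L n` diverge. -/
lemma pi_le_norm_of_isHilbertOperator {H : lp (fun _ : ℕ => ℝ) 2 →L[ℝ] lp (fun _ : ℕ => ℝ) 2}
    (hH : IsHilbertOperator H) : Real.pi ≤ ‖H‖ := by
  set L : ℕ → ℝ := fun n => ∑ r ∈ Finset.range n, 1 / ((r : ℝ) + 1) with hL
  have key : ∀ n, Real.pi * L n - 12 ≤ ‖H‖ * L n := by
    intro n
    set v : lp (fun _ : ℕ => ℝ) 2 :=
      ∑ s ∈ Finset.range n, lp.single 2 s (1 / Real.sqrt ((s : ℝ) + 1)) with hv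
    have hvn : ‖v‖ ^ 2 = L n := by
      have := lp.norm_sum_single (p := 2) (E := fun _ : ℕ => ℝ) (by norm_num)
        (fun s => 1 / Real.sqrt ((s : ℝ) + 1)) (Finset.range n)
      simp only [ENNReal.toReal_ofNat, Real.rpow_ofNat, Real.norm_eq_abs, sq_abs] at this
      rw [hv, this]
      refine Finset.sum_congr rfl fun s _ => ?_
      rw [div_pow, Real.sq_sqrt (by positivity), one_pow]
    have hHv : ∀ r, (H v : ℕ → ℝ) r =
        ∑ s ∈ Finset.range n, 1 / Real.sqrt ((s : ℝ) + 1) * (1 / ((r : ℝ) + s + 1)) := by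
      intro r
      rw [hv, map_sum, lp.coeFn_sum, Finset.sum_apply]
      refine Finset.sum_congr rfl fun s _ => ?_
      have h1 : lp.single (E := fun _ : ℕ => ℝ) 2 s (1 / Real.sqrt ((s : ℝ) + 1)) =
          (1 / Real.sqrt ((s : ℝ) + 1)) • lp.single 2 s (1 : ℝ) := by
        rw [← lp.single_smul, smul_eq_mul, mul_one]
      rw [h1, map_smul, lp.coeFn_smul, Pi.smul_apply, smul_eq_mul, hH]
      push_cast
      congr 2
      ring
    have hin : inner ℝ v (H v) = ∑ r ∈ Finset.range n, ∑ s ∈ Finset.range n,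
        1 / Real.sqrt ((r : ℝ) + 1) * (1 / Real.sqrt (s + 1)) * (1 / ((r : ℝ) + s + 1)) := by
      conv_lhs => rw [hv, sum_inner]
      refine Finset.sum_congr rfl fun r _ => ?_
      rw [lp.inner_single_left, ← hv, hHv]
      simp only [RCLike.inner_apply, conj_trivial, Finset.sum_mul]
      exact Finset.sum_congr rfl fun s _ => by ring
    calc Real.pi * L n - 12 ≤ inner ℝ v (H v) := by rw [hin]; exact sum_hilbert_ge n
      _ ≤ ‖v‖ * ‖H v‖ := real_inner_le_norm _ _
      _ ≤ ‖v‖ * (‖H‖ * ‖v‖) := by gcongr; exact H.le_opNorm v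
      _ = ‖H‖ * L n := by rw [← hvn]; ring
  by_contra h
  push Not at h
  have hd : 0 < Real.pi - ‖H‖ := by linarith
  obtain ⟨n, hn⟩ := ((Real.tendsto_sum_range_one_div_nat_succ_atTop).eventually_gt_atTop
    (12 / (Real.pi - ‖H‖))).exists
  have h1 := key n
  have h2 : 12 / (Real.pi - ‖H‖) < L n := hn
  rw [div_lt_iff₀ hd] at h2
  linarith

lemma norm_hilbertOperator : ‖hilbertOperator‖ = Real.pi :=
  le_antisymm norm_hilbertOperator_le
    (pi_le_norm_of_isHilbertOperator isHilbertOperator_hilbertOperator)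

/-! ### Bipartite Hankel matrices and the monotonicity of their norms -/

/-- The symmetric matrix with off-diagonal blocks `[g (r + s + 1)]`, `r < p`, `s < q`. -/
def bipHankel (g : ℕ → ℝ) (p q : ℕ) : Matrix (Fin p ⊕ Fin q) (Fin p ⊕ Fin q) ℝ :=
  Matrix.fromBlocks 0 (Matrix.of fun r s => g (r + s + 1)) (Matrix.of fun s r => g (r + s + 1)) 0

lemma isSymm_bipHankel (g : ℕ → ℝ) (p q : ℕ) : (bipHankel g p q).IsSymm := by
  refine Matrix.IsSymm.fromBlocks (by simp [Matrix.IsSymm]) ?_ (by simp [Matrix.IsSymm])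
  rfl

lemma bipHankel_nonneg {g : ℕ → ℝ} (hg : ∀ d, 0 ≤ g d) (p q : ℕ) (i j : Fin p ⊕ Fin q) :
    0 ≤ bipHankel g p q i j := by
  rcases i with i | i <;> rcases j with j | j <;> simp [bipHankel, hg]

lemma quadForm_bipHankel (g : ℕ → ℝ) (p q : ℕ) (u : Fin p ⊕ Fin q → ℝ) :
    quadForm (bipHankel g p q) u =
      2 * ∑ r : Fin p, ∑ s : Fin q, u (Sum.inl r) * u (Sum.inr s) * g (r + s + 1) := by
  simp only [quadForm, bipHankel, Fintype.sum_sum_type, Matrix.fromBlocks_apply₁₁,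
    Matrix.fromBlocks_apply₁₂, Matrix.fromBlocks_apply₂₁, Matrix.fromBlocks_apply₂₂,
    Matrix.zero_apply, zero_mul, Finset.sum_const_zero, zero_add, add_zero, Matrix.of_apply]
  rw [Finset.sum_comm (s := (Finset.univ : Finset (Fin q))), two_mul]
  congr 1 <;>
  exact Finset.sum_congr rfl fun r _ => Finset.sum_congr rfl fun s _ => by ring

/-- The quadratic form of `bipHankel` on a pair of sequences. -/
lemma hankel_form_le_specNorm (g : ℕ → ℝ) (p q : ℕ) (x y : ℕ → ℝ) :
    2 * ∑ r ∈ Finset.range p, ∑ s ∈ Finset.range q, x r * y s * g (r + s + 1) ≤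
      specNorm (bipHankel g p q) * (∑ r ∈ Finset.range p, x r ^ 2 + ∑ s ∈ Finset.range q, y s ^ 2) := by
  have h := quadForm_le_specNorm (bipHankel g p q)
    (Sum.elim (fun r : Fin p => x r) (fun s : Fin q => y s))
  rw [quadForm_bipHankel, Fintype.sum_sum_type] at h
  simpa only [Sum.elim_inl, Sum.elim_inr, Finset.sum_range] using h

lemma specNorm_bipHankel_le {g : ℕ → ℝ} (hg : ∀ d, 0 ≤ g d) {p q : ℕ} {c : ℝ} (hc : 0 ≤ c)
    (h : ∀ x y : ℕ → ℝ, (∀ r, 0 ≤ x r) → (∀ s, 0 ≤ y s) →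
      2 * ∑ r ∈ Finset.range p, ∑ s ∈ Finset.range q, x r * y s * g (r + s + 1) ≤
        c * (∑ r ∈ Finset.range p, x r ^ 2 + ∑ s ∈ Finset.range q, y s ^ 2)) :
    specNorm (bipHankel g p q) ≤ c := by
  refine specNorm_le (isSymm_bipHankel g p q) (bipHankel_nonneg hg p q) hc fun u hu => ?_
  have h1 := h (fun r => if hr : r < p then u (Sum.inl ⟨r, hr⟩) else 0)
    (fun s => if hs : s < q then u (Sum.inr ⟨s, hs⟩) else 0)
    (fun r => by split_ifs <;> simp [hu])
    (fun s => by split_ifs <;> simp [hu])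
  rw [quadForm_bipHankel, Fintype.sum_sum_type]
  simpa only [Finset.sum_range, Fin.is_lt, dif_pos, Fin.eta] using h1

/-- A pair of non-negative singular sequences of the Hankel block. -/
lemma exists_singular_pair {g : ℕ → ℝ} (hg : ∀ d, 0 ≤ g d) {p q : ℕ} (hp : 0 < p) :
    ∃ x y : ℕ → ℝ, (∀ r, 0 ≤ x r) ∧ (∀ s, 0 ≤ y s) ∧
      0 < ∑ r ∈ Finset.range p, x r ^ 2 + ∑ s ∈ Finset.range q, y s ^ 2 ∧
      (∀ r < p, ∑ s ∈ Finset.range q, y s * g (r + s + 1) = specNorm (bipHankel g p q) * x r) ∧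
      ∀ s < q, ∑ r ∈ Finset.range p, x r * g (r + s + 1) = specNorm (bipHankel g p q) * y s := by
  have : Nonempty (Fin p ⊕ Fin q) := ⟨Sum.inl ⟨0, hp⟩⟩
  obtain ⟨u, hu, hpos, heq⟩ := exists_perron_vector (isSymm_bipHankel g p q)
    (bipHankel_nonneg hg p q)
  refine ⟨fun r => if hr : r < p then u (Sum.inl ⟨r, hr⟩) else 0,
    fun s => if hs : s < q then u (Sum.inr ⟨s, hs⟩) else 0,
    fun r => by dsimp only; split_ifs <;> simp [hu],
    fun s => by dsimp only; split_ifs <;> simp [hu], ?_, fun r hr => ?_, fun s hs => ?_⟩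
  · rw [Fintype.sum_sum_type] at hpos
    simpa only [Finset.sum_range, Fin.is_lt, dif_pos, Fin.eta] using hpos
  · have := heq (Sum.inl ⟨r, hr⟩)
    rw [Fintype.sum_sum_type] at this
    simp only [Finset.sum_range, Fin.is_lt, dif_pos, Fin.eta, hr]
    rw [← this]
    simp [bipHankel, mul_comm]
  · have := heq (Sum.inr ⟨s, hs⟩)
    rw [Fintype.sum_sum_type] at this
    simp only [Finset.sum_range, Fin.is_lt, dif_pos, Fin.eta, hs]
    rw [← this]
    simp [bipHankel, mul_comm]

lemma specNorm_bipHankel_comm {g : ℕ → ℝ} (hg : ∀ d, 0 ≤ g d) (p q : ℕ) :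
    specNorm (bipHankel g p q) = specNorm (bipHankel g q p) := by
  have : ∀ p q, specNorm (bipHankel g p q) ≤ specNorm (bipHankel g q p) := fun p q =>
    specNorm_bipHankel_le hg (specNorm_nonneg _) fun x y _ _ => by
      have h := hankel_form_le_specNorm g q p y x
      rw [Finset.sum_comm, add_comm (∑ s ∈ Finset.range q, y s ^ 2)] at h
      refine le_trans (le_of_eq ?_) h
      congr 1
      refine Finset.sum_congr rfl fun r _ => Finset.sum_congr rfl fun s _ => ?_
      rw [mul_comm (x r), add_comm r s]
  exact le_antisymm (this p q) (this q p)

/-- The kernel of the search matrix. -/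
def invKernel (d : ℕ) : ℝ := 1 / (d : ℝ)

lemma invKernel_nonneg (d : ℕ) : 0 ≤ invKernel d := by unfold invKernel; positivity

/-- The corner entry of the block is `1`. This is what supplies `σ ≥ 1` in the monotonicity
argument. -/
lemma one_le_specNorm_bipHankel {p q : ℕ} (hp : 0 < p) (hq : 0 < q) :
    1 ≤ specNorm (bipHankel invKernel p q) := by
  have h := hankel_form_le_specNorm invKernel p q (fun r => if r = 0 then 1 else 0)
    (fun s => if s = 0 then 1 else 0)
  simp [hp, hq, invKernel] at h
  linarith

/-! ### Monotonicity of the norm in the split of the indices. -/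

/-- The Hilbert matrix is the Gram matrix of the monomials in `L²(0, 1)`. -/
lemma hilbert_form_nonneg (p : ℕ) (d : ℕ → ℝ) :
    0 ≤ ∑ r ∈ Finset.range p, ∑ k ∈ Finset.range p, d r * d k * (1 / ((r : ℝ) + k + 1)) := by
  have h1 : ∫ t in (0 : ℝ)..1, (∑ r ∈ Finset.range p, d r * t ^ r) ^ 2 =
      ∑ r ∈ Finset.range p, ∑ k ∈ Finset.range p, d r * d k * (1 / ((r : ℝ) + k + 1)) := by
    have h2 : ∀ t : ℝ, (∑ r ∈ Finset.range p, d r * t ^ r) ^ 2 =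
        ∑ r ∈ Finset.range p, ∑ k ∈ Finset.range p, d r * d k * t ^ (r + k) := by
      intro t
      rw [sq, Finset.sum_mul_sum]
      refine Finset.sum_congr rfl fun r _ => Finset.sum_congr rfl fun k _ => ?_
      rw [pow_add]
      ring
    simp only [h2]
    rw [intervalIntegral.integral_finsetSum fun r _ =>
      Continuous.intervalIntegrable (by fun_prop) _ _]
    refine Finset.sum_congr rfl fun r _ => ?_
    rw [intervalIntegral.integral_finsetSum fun r _ =>
      Continuous.intervalIntegrable (by fun_prop) _ _]
    refine Finset.sum_congr rfl fun k _ => ?_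
    rw [intervalIntegral.integral_const_mul, integral_pow]
    simp
  rw [← h1]
  exact intervalIntegral.integral_nonneg zero_le_one fun t _ => sq_nonneg _

lemma sum_inv_sq_le (p : ℕ) (s : ℝ) (hs : 0 ≤ s) :
    ∑ r ∈ Finset.range p, (1 / ((r : ℝ) + s + 1)) ^ 2 ≤ 1 / (s + 1 / 2) - 1 / (s + p + 1 / 2) := by
  induction p with
  | zero => simp
  | succ p ih =>
    rw [Finset.sum_range_succ]
    have h : (1 / ((p : ℝ) + s + 1)) ^ 2 ≤ 1 / (s + p + 1 / 2) - 1 / (s + (p + 1) + 1 / 2) := by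
      have hp : (0 : ℝ) ≤ p := Nat.cast_nonneg p
      rw [div_sub_div _ _ (by positivity) (by positivity), div_pow,
        div_le_div_iff₀ (by positivity) (by positivity)]
      nlinarith
    push_cast
    linarith

/-- The factors are the squared lengths of columns `p` and `s` of the Hilbert matrix cut to `p`
rows, and the right side is the squared entry at `(p, s)`. It converts a Cauchy–Schwarz estimate
back into an entrywise one. -/
lemma sum_inv_sq_mul_sum_inv_sq_le {p s : ℕ} (hp : 0 < p) (hs : p ≤ s) :
    (∑ r ∈ Finset.range p, (1 / ((r : ℝ) + p + 1)) ^ 2) *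
      (∑ r ∈ Finset.range p, (1 / ((r : ℝ) + s + 1)) ^ 2) ≤ (1 / ((p : ℝ) + s + 1)) ^ 2 := by
  have hp' : (1 : ℝ) ≤ p := by exact_mod_cast hp
  have hs' : (p : ℝ) ≤ s := by exact_mod_cast hs
  have h1 := sum_inv_sq_le p (p : ℝ) (by positivity)
  have h2 := sum_inv_sq_le p (s : ℝ) (by positivity)
  refine (mul_le_mul h1 h2 (Finset.sum_nonneg fun _ _ => sq_nonneg _)
    ((Finset.sum_nonneg fun _ _ => sq_nonneg _).trans h1)).trans ?_
  set P : ℝ := (p : ℝ)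
  set S : ℝ := (s : ℝ)
  have e1 : 1 / (P + 1 / 2) - 1 / (P + P + 1 / 2) = P / ((P + 1 / 2) * (P + P + 1 / 2)) := by
    field_simp
    ring
  have hS0 : 0 < S := by linarith
  have e2 : 1 / (S + 1 / 2) - 1 / (S + P + 1 / 2) = P / ((S + 1 / 2) * (S + P + 1 / 2)) := by
    field_simp
    ring
  rw [e1, e2, div_mul_div_comm, div_pow, one_pow, div_le_div_iff₀ (by positivity) (by positivity)]
  have k1 : P * (P + S + 1) ≤ (P + P + 1 / 2) * (S + 1 / 2) := by nlinarith
  have k2 : P * (P + S + 1) ≤ (P + 1 / 2) * (S + P + 1 / 2) := by nlinarith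
  calc P * P * (P + S + 1) ^ 2 = (P * (P + S + 1)) * (P * (P + S + 1)) := by ring
    _ ≤ ((P + P + 1 / 2) * (S + 1 / 2)) * ((P + 1 / 2) * (S + P + 1 / 2)) :=
      mul_le_mul k1 k2 (by positivity) (by positivity)
    _ = _ := by ring

/-- If `(σ + H) d = e` for the Hilbert matrix `H` and `σ ≥ 1`, where `e` is a combination of later
columns of `H` with non-negative weights, then the next entry `e_p - ⟨h_p, d⟩` is non-negative. -/
lemma resolvent_hilbert_next_nonneg {p q : ℕ} (hp : 0 < p) {σ : ℝ} (hσ : 1 ≤ σ) {d w : ℕ → ℝ}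
    (hw : ∀ k, 0 ≤ w k)
    (hd : ∀ r < p, σ * d r + ∑ k ∈ Finset.range p, d k * (1 / ((r : ℝ) + k + 1)) =
      ∑ k ∈ Finset.Ico p q, w k * (1 / ((r : ℝ) + k + 1))) :
    ∑ k ∈ Finset.range p, d k * (1 / ((p : ℝ) + k + 1)) ≤
      ∑ k ∈ Finset.Ico p q, w k * (1 / ((p : ℝ) + k + 1)) := by
  set h : ℕ → ℝ := fun s => Real.sqrt (∑ r ∈ Finset.range p, (1 / ((r : ℝ) + s + 1)) ^ 2) with hh
  set D := Real.sqrt (∑ r ∈ Finset.range p, d r ^ 2) with hD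
  have hD2 : D ^ 2 = ∑ r ∈ Finset.range p, d r ^ 2 :=
    Real.sq_sqrt (Finset.sum_nonneg fun _ _ => sq_nonneg _)
  have hD0 : 0 ≤ D := Real.sqrt_nonneg _
  have hcs : ∀ s : ℕ, ∑ r ∈ Finset.range p, d r * (1 / ((r : ℝ) + s + 1)) ≤ D * h s := fun s =>
    Real.sum_mul_le_sqrt_mul_sqrt _ _ _
  -- Pair the equation for `d` with `d` and discard the non-negative Hilbert form; `h k` is the
  -- length of column `k` cut to `p` rows.
  have h1 : σ * D ^ 2 ≤ D * ∑ k ∈ Finset.Ico p q, w k * h k := by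
    have e1 : ∑ r ∈ Finset.range p,
        d r * (σ * d r + ∑ k ∈ Finset.range p, d k * (1 / ((r : ℝ) + k + 1))) =
        σ * D ^ 2 + ∑ r ∈ Finset.range p, ∑ k ∈ Finset.range p,
          d r * d k * (1 / ((r : ℝ) + k + 1)) := by
      rw [hD2, Finset.mul_sum, ← Finset.sum_add_distrib]
      refine Finset.sum_congr rfl fun r _ => ?_
      rw [mul_add, Finset.mul_sum]
      congr 1
      · ring
      · exact Finset.sum_congr rfl fun k _ => by ring
    have e2 : ∑ r ∈ Finset.range p,
        d r * (σ * d r + ∑ k ∈ Finset.range p, d k * (1 / ((r : ℝ) + k + 1))) =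
        ∑ k ∈ Finset.Ico p q, w k * ∑ r ∈ Finset.range p, d r * (1 / ((r : ℝ) + k + 1)) := by
      simp only [Finset.mul_sum (s := Finset.range p)]
      rw [Finset.sum_comm]
      refine Finset.sum_congr rfl fun r hr => ?_
      rw [hd r (Finset.mem_range.1 hr), Finset.mul_sum]
      exact Finset.sum_congr rfl fun k _ => by ring
    have e3 := hilbert_form_nonneg p d
    have e4 : ∑ k ∈ Finset.Ico p q, w k * ∑ r ∈ Finset.range p, d r * (1 / ((r : ℝ) + k + 1)) ≤
        D * ∑ k ∈ Finset.Ico p q, w k * h k := by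
      rw [Finset.mul_sum]
      refine Finset.sum_le_sum fun k _ => ?_
      calc _ ≤ w k * (D * h k) := mul_le_mul_of_nonneg_left (hcs k) (hw k)
        _ = _ := by ring
    linarith
  have hW0 : 0 ≤ ∑ k ∈ Finset.Ico p q, w k * h k :=
    Finset.sum_nonneg fun k _ => mul_nonneg (hw k) (Real.sqrt_nonneg _)
  have h2 : D ≤ ∑ k ∈ Finset.Ico p q, w k * h k := by
    by_contra hc
    push Not at hc
    nlinarith
  have h3 := hcs p
  have h4 : ∀ k ∈ Finset.Ico p q, h k * h p ≤ 1 / ((p : ℝ) + k + 1) := by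
    intro k hk
    rw [mul_comm, hh, ← Real.sqrt_mul (Finset.sum_nonneg fun _ _ => sq_nonneg _)]
    exact Real.sqrt_le_iff.2 ⟨by positivity,
      sum_inv_sq_mul_sum_inv_sq_le hp (Finset.mem_Ico.1 hk).1⟩
  calc ∑ k ∈ Finset.range p, d k * (1 / ((p : ℝ) + k + 1))
      = ∑ k ∈ Finset.range p, d k * (1 / ((k : ℝ) + p + 1)) := by
        refine Finset.sum_congr rfl fun k _ => ?_
        rw [add_comm (p : ℝ)]
    _ ≤ D * h p := h3
    _ ≤ (∑ k ∈ Finset.Ico p q, w k * h k) * h p :=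
        mul_le_mul_of_nonneg_right h2 (Real.sqrt_nonneg _)
    _ = ∑ k ∈ Finset.Ico p q, w k * (h k * h p) := by
        rw [Finset.sum_mul]
        exact Finset.sum_congr rfl fun k _ => by ring
    _ ≤ _ := Finset.sum_le_sum fun k hk => mul_le_mul_of_nonneg_left (h4 k hk) (hw k)

/-- Moving one index from the longer side to the shorter side does not decrease the norm. -/
lemma specNorm_bipHankel_succ_le {p q : ℕ} (hp : 0 < p) (hpq : p + 1 ≤ q) :
    specNorm (bipHankel invKernel p (q + 1)) ≤ specNorm (bipHankel invKernel (p + 1) q) := by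
  set σ := specNorm (bipHankel invKernel p (q + 1)) with hσdef
  have hσ : 1 ≤ σ := one_le_specNorm_bipHankel hp (Nat.succ_pos q)
  obtain ⟨x, y, hx, hy, hpos, hxe, hye⟩ := exists_singular_pair invKernel_nonneg (q := q + 1) hp
  rw [← hσdef] at hxe hye
  have hg : ∀ r s : ℕ, invKernel (r + s + 1) = 1 / ((r : ℝ) + s + 1) := fun r s => by
    simp [invKernel]
  simp only [hg] at hxe hye
  set b := y q with hb
  have hb0 : 0 ≤ b := hy q
  -- the extension of `x` dominates the entry of `y` at the index `p`
  have hE : σ * y p ≤ ∑ s ∈ Finset.range (q + 1), y s * (1 / ((p : ℝ) + s + 1)) := by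
    -- Subtracting the two singular equations for `r < p` gives `(σ + H)(x - y)` as the combination
    -- of the columns `p, …, q` with weights `y`.
    have h1 := resolvent_hilbert_next_nonneg (q := q + 1) hp hσ (d := fun r => x r - y r) hy
      (fun r hr => by
        have e1 := hxe r hr
        have e2 := hye r (by omega)
        rw [← Finset.sum_range_add_sum_Ico _ (by omega : p ≤ q + 1)] at e1
        have e3 : ∑ k ∈ Finset.range p, x k * (1 / ((k : ℝ) + r + 1)) =
            ∑ k ∈ Finset.range p, x k * (1 / ((r : ℝ) + k + 1)) :=
          Finset.sum_congr rfl fun k _ => by rw [add_comm (k : ℝ)]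
        simp only [sub_mul, Finset.sum_sub_distrib]
        rw [mul_sub]
        linarith)
    have e2 := hye p (by omega)
    have e3 : ∑ k ∈ Finset.range p, x k * (1 / ((k : ℝ) + p + 1)) =
        ∑ k ∈ Finset.range p, x k * (1 / ((p : ℝ) + k + 1)) :=
      Finset.sum_congr rfl fun k _ => by rw [add_comm (k : ℝ)]
    simp only [sub_mul, Finset.sum_sub_distrib] at h1
    rw [← Finset.sum_range_add_sum_Ico _ (by omega : p ≤ q + 1)]
    linarith
  -- Both sides are compared as sums over `x r`, after enlarging `b` to `σ b`; termwise it reduces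
  -- to `r + p + 1 ≤ (p + q + 1)(q - p)`, which holds since `q - p ≥ 1`. It pays for the term `s =
  -- q` that is lost from `hE`.
  have hgap : b * (1 / ((p : ℝ) + q + 1)) ≤ σ * y p - σ * b := by
    rw [← hye p (by omega), ← hye q (by omega), ← Finset.sum_sub_distrib]
    have hpq' : (p : ℝ) + 1 ≤ q := by exact_mod_cast hpq
    have hp' : (1 : ℝ) ≤ p := by exact_mod_cast hp
    calc b * (1 / ((p : ℝ) + q + 1)) ≤ (σ * b) * (1 / ((p : ℝ) + q + 1)) := by
          refine mul_le_mul_of_nonneg_right ?_ (by positivity)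
          nlinarith
      _ ≤ _ := by
          rw [← hye q (by omega), Finset.sum_mul]
          refine Finset.sum_le_sum fun r hr => ?_
          have hr' : (r : ℝ) + 1 ≤ p := by exact_mod_cast Finset.mem_range.1 hr
          rw [mul_assoc, ← mul_sub]
          refine mul_le_mul_of_nonneg_left ?_ (hx r)
          rw [one_div_mul_one_div, div_sub_div _ _ (by positivity) (by positivity),
            div_le_div_iff₀ (by positivity) (by positivity)]
          have hr0 : (0 : ℝ) ≤ r := Nat.cast_nonneg r
          have : (r : ℝ) + p + 1 ≤ (p + q + 1) * (q - p) := by nlinarith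
          have hq0 : 0 ≤ ((r : ℝ) + q + 1) := by positivity
          nlinarith [mul_le_mul_of_nonneg_left this hq0]
  have hkey : σ * b ≤ ∑ s ∈ Finset.range q, y s * (1 / ((p : ℝ) + s + 1)) := by
    rw [Finset.sum_range_succ, ← hb] at hE
    linarith
  -- the test vector
  have ht := hankel_form_le_specNorm invKernel (p + 1) q (fun r => if r = p then b else x r) y
  simp only [hg] at ht
  rw [Finset.sum_range_succ, Finset.sum_range_succ] at ht
  simp only [if_true] at ht
  have t1 : ∀ f : ℕ → ℝ → ℝ, ∑ r ∈ Finset.range p, f r (if r = p then b else x r) =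
      ∑ r ∈ Finset.range p, f r (x r) := fun f =>
    Finset.sum_congr rfl fun r hr => by rw [if_neg (Finset.mem_range.1 hr).ne]
  rw [t1 fun r z => ∑ s ∈ Finset.range q, z * y s * (1 / ((r : ℝ) + s + 1)),
    t1 fun r z => z ^ 2] at ht
  have t2 : ∑ s ∈ Finset.range q, b * y s * (1 / ((p : ℝ) + s + 1)) =
      b * ∑ s ∈ Finset.range q, y s * (1 / ((p : ℝ) + s + 1)) := by
    rw [Finset.mul_sum]
    exact Finset.sum_congr rfl fun s _ => by ring
  have t3 : ∑ r ∈ Finset.range p, ∑ s ∈ Finset.range (q + 1),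
      x r * y s * (1 / ((r : ℝ) + s + 1)) = σ * ∑ r ∈ Finset.range p, x r ^ 2 := by
    rw [Finset.mul_sum]
    refine Finset.sum_congr rfl fun r hr => ?_
    rw [sq, ← mul_assoc, ← hxe r (Finset.mem_range.1 hr), Finset.sum_mul]
    exact Finset.sum_congr rfl fun s _ => by ring
  have t4 : ∑ r ∈ Finset.range p, ∑ s ∈ Finset.range (q + 1),
      x r * y s * (1 / ((r : ℝ) + s + 1)) = σ * ∑ s ∈ Finset.range (q + 1), y s ^ 2 := by
    rw [Finset.sum_comm, Finset.mul_sum]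
    refine Finset.sum_congr rfl fun s hs => ?_
    rw [sq, ← mul_assoc, ← hye s (Finset.mem_range.1 hs), Finset.sum_mul]
    exact Finset.sum_congr rfl fun r _ => by ring
  have t5 : ∑ r ∈ Finset.range p, ∑ s ∈ Finset.range (q + 1),
      x r * y s * (1 / ((r : ℝ) + s + 1)) =
      ∑ r ∈ Finset.range p, ∑ s ∈ Finset.range q, x r * y s * (1 / ((r : ℝ) + s + 1)) +
        b * (σ * b) := by
    simp only [Finset.sum_range_succ, Finset.sum_add_distrib]
    congr 1
    rw [← hye q (by omega), Finset.mul_sum]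
    exact Finset.sum_congr rfl fun r _ => by ring
  have t6 : ∑ s ∈ Finset.range (q + 1), y s ^ 2 = ∑ s ∈ Finset.range q, y s ^ 2 + b ^ 2 :=
    Finset.sum_range_succ _ _
  rw [t2] at ht
  -- The mass `b` has moved from index `q` of the long side to index `p` of the short side. The norm
  -- is unchanged; up to the common factor `2`, the form loses `σ b²` and gains at least as much by
  -- `hkey`.
  have t7 := mul_le_mul_of_nonneg_left hkey hb0
  set X := ∑ r ∈ Finset.range p, x r ^ 2
  set Y := ∑ s ∈ Finset.range (q + 1), y s ^ 2
  have t8 : σ * (X + Y) ≤ specNorm (bipHankel invKernel (p + 1) q) * (X + Y) := by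
    have : X + b ^ 2 + ∑ s ∈ Finset.range q, y s ^ 2 = X + Y := by rw [t6]; ring
    rw [this] at ht
    linarith
  exact le_of_mul_le_mul_right t8 hpos

lemma specNorm_bipHankel_le_half {p q : ℕ} (hpq : p ≤ q) :
    specNorm (bipHankel invKernel p q) ≤
      specNorm (bipHankel invKernel ((p + q) / 2) (p + q - (p + q) / 2)) := by
  rcases Nat.eq_zero_or_pos p with rfl | hp
  · refine specNorm_bipHankel_le invKernel_nonneg (specNorm_nonneg _) fun x y _ _ => ?_
    have : 0 ≤ ∑ s ∈ Finset.range q, y s ^ 2 := Finset.sum_nonneg fun _ _ => sq_nonneg _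
    simpa using mul_nonneg (specNorm_nonneg _) this
  obtain ⟨k, rfl⟩ := Nat.exists_eq_add_of_le hpq
  -- The induction is on the gap `q - p`; each transfer lowers it by `2`, and a gap below `2` is
  -- already balanced.
  induction k using Nat.strong_induction_on generalizing p with
  | _ k ih =>
    rcases lt_or_ge k 2 with hk | hk
    · have h1 : (p + (p + k)) / 2 = p := by omega
      have h2 : p + (p + k) - p = p + k := by omega
      rw [h1, h2]
    · obtain ⟨m, rfl⟩ := Nat.exists_eq_add_of_le hk
      have h1 := specNorm_bipHankel_succ_le hp (q := p + 1 + m) (by omega)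
      have h2 := ih m (by omega) (p := p + 1) (by omega) (by omega)
      have e : p + 1 + (p + 1 + m) = p + (p + (2 + m)) := by ring
      rw [e] at h2
      refine le_trans ?_ h2
      rwa [show p + (2 + m) = p + 1 + m + 1 by ring]

lemma specNorm_bipHankel_le_balanced (p q : ℕ) :
    specNorm (bipHankel invKernel p q) ≤
      specNorm (bipHankel invKernel ((p + q) / 2) (p + q - (p + q) / 2)) := by
  rcases le_total p q with h | h
  · exact specNorm_bipHankel_le_half h
  · rw [specNorm_bipHankel_comm invKernel_nonneg, add_comm p q]
    exact specNorm_bipHankel_le_half h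

/-! ### The spectral adversary bound -/

section Adversary

variable {N : ℕ} {α : Type}

/-- The real part of the inner product of two vectors. -/
def overlap {β : Type} [Fintype β] (ψ φ : β → ℂ) : ℝ := (star ψ ⬝ᵥ φ).re

lemma overlap_eq_sum {β : Type} [Fintype β] (ψ φ : β → ℂ) :
    overlap ψ φ = ∑ b, (star (ψ b) * φ b).re := by
  simp [overlap, dotProduct]

lemma overlap_self {β : Type} [Fintype β] (ψ : β → ℂ) : overlap ψ ψ = ∑ b, ‖ψ b‖ ^ 2 := by
  rw [overlap_eq_sum]
  refine Finset.sum_congr rfl fun b _ => ?_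
  rw [Complex.star_def, ← Complex.normSq_eq_conj_mul_self, Complex.ofReal_re,
    Complex.normSq_eq_norm_sq]

lemma overlap_unitary {β : Type} [Fintype β] [DecidableEq β] (U : Matrix.unitaryGroup β ℂ)
    (ψ φ : β → ℂ) :
    overlap ((U : Matrix β β ℂ).mulVec ψ) ((U : Matrix β β ℂ).mulVec φ) = overlap ψ φ := by
  have hU : (U : Matrix β β ℂ).conjTranspose * U = 1 :=
    Matrix.mem_unitaryGroup_iff'.1 U.2
  rw [overlap, overlap, Matrix.star_mulVec, ← Matrix.dotProduct_mulVec, Matrix.mulVec_mulVec, hU,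
    Matrix.one_mulVec]

lemma re_star_mul_le (a b : ℂ) : |(star a * b).re| ≤ ‖a‖ * ‖b‖ :=
  (Complex.abs_re_le_norm _).trans_eq (by rw [norm_mul, norm_star])

/-- The sign that the phase oracle gives to a basis state. -/
def oracleSign (x : Fin N → Bool) : Option (Fin N) → ℝ
  | none => 1
  | some i => if x i = true then -1 else 1

lemma phaseOracle_mulVec {w : ℕ} (x : Fin N → Bool) (ψ : QBasis N w → ℂ) (b : QBasis N w) :
    (phaseOracle w x).mulVec ψ b = (oracleSign x b.1 : ℂ) * ψ b := by
  rw [phaseOracle, Matrix.mulVec_diagonal]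
  congr 1
  rcases b with ⟨_ | i, z⟩
  · simp [oracleSign]
  · simp only [oracleSign]
    split_ifs <;> simp

lemma oracleSign_sq (x : Fin N → Bool) (o : Option (Fin N)) : oracleSign x o ^ 2 = 1 := by
  rcases o with _ | i
  · simp [oracleSign]
  · simp only [oracleSign]
    split_ifs <;> norm_num

/-- The oracle multiplies each term of the overlap by the product of two signs, so only basis states
querying a bit where `x` and `y` differ contribute. -/
lemma overlap_sub_overlap_phaseOracle_le {w : ℕ} (x y : Fin N → Bool) (ψ φ : QBasis N w → ℂ) :
    overlap ψ φ - overlap ((phaseOracle w x).mulVec ψ) ((phaseOracle w y).mulVec φ) ≤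
      ∑ b : QBasis N w, (1 - oracleSign x b.1 * oracleSign y b.1) * (‖ψ b‖ * ‖φ b‖) := by
  rw [overlap_eq_sum, overlap_eq_sum, ← Finset.sum_sub_distrib]
  refine Finset.sum_le_sum fun b _ => ?_
  rw [phaseOracle_mulVec, phaseOracle_mulVec]
  have h1 : (star ((oracleSign x b.1 : ℂ) * ψ b) * ((oracleSign y b.1 : ℂ) * φ b)).re =
      oracleSign x b.1 * oracleSign y b.1 * (star (ψ b) * φ b).re := by
    rw [star_mul', Complex.star_def, Complex.conj_ofReal, mul_mul_mul_comm, ← Complex.ofReal_mul,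
      Complex.re_ofReal_mul]
  rw [h1]
  have h2 : 0 ≤ 1 - oracleSign x b.1 * oracleSign y b.1 := by
    nlinarith [oracleSign_sq x b.1, oracleSign_sq y b.1,
      sq_nonneg (oracleSign x b.1 - oracleSign y b.1)]
  calc _ = (1 - oracleSign x b.1 * oracleSign y b.1) * (star (ψ b) * φ b).re := by ring
    _ ≤ _ := mul_le_mul_of_nonneg_left ((le_abs_self _).trans (re_star_mul_le _ _)) h2

lemma norm_sq_state (A : QueryAlgorithm N α) (x : Fin N → Bool) (t : ℕ) :
    ∑ b, ‖A.state x t b‖ ^ 2 = 1 := by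
  rw [← overlap_self]
  induction t with
  | zero =>
    rw [QueryAlgorithm.state, overlap_unitary, overlap_self,
      Finset.sum_eq_single ((none, 0) : QBasis N A.work)]
    · simp
    · intro b _ hb
      simp [Pi.single_eq_of_ne hb]
    · simp
  | succ t ih =>
    rw [QueryAlgorithm.state, overlap_unitary, ← ih, overlap_self, overlap_self]
    refine Finset.sum_congr rfl fun b _ => ?_
    rw [phaseOracle_mulVec, norm_mul, mul_pow, Complex.norm_real, Real.norm_eq_abs, sq_abs,
      oracleSign_sq, one_mul]

/-- The weighted sum of the overlaps of the states after `t` queries. -/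
def progress (A : QueryAlgorithm N α) (G : Matrix (Fin N → Bool) (Fin N → Bool) ℝ)
    (δ : (Fin N → Bool) → ℝ) (t : ℕ) : ℝ :=
  ∑ x, ∑ y, G x y * (δ x * δ y) * overlap (A.state x t) (A.state y t)

lemma progress_zero (A : QueryAlgorithm N α) (G : Matrix (Fin N → Bool) (Fin N → Bool) ℝ)
    (δ : (Fin N → Bool) → ℝ) : progress A G δ 0 = quadForm G δ := by
  refine Finset.sum_congr rfl fun x _ => Finset.sum_congr rfl fun y _ => ?_
  have h : overlap (A.state x 0) (A.state y 0) = 1 := by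
    have := norm_sq_state A x 0
    rwa [← overlap_self] at this
  rw [h, mul_one]

lemma progress_sub_progress_succ_le (A : QueryAlgorithm N α)
    {G : Matrix (Fin N → Bool) (Fin N → Bool) ℝ} (hG : ∀ x y, 0 ≤ G x y)
    {δ : (Fin N → Bool) → ℝ} (hδ : ∀ x, 0 ≤ δ x) {c : ℝ} (hc0 : 0 ≤ c)
    (hc : ∀ i, specNorm (queryMatrix G i) ≤ c) (t : ℕ) :
    progress A G δ t - progress A G δ (t + 1) ≤ 2 * c * ∑ x, δ x ^ 2 := by
  have h1 : progress A G δ t - progress A G δ (t + 1) ≤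
      ∑ b : QBasis N A.work, ∑ x, ∑ y, G x y * (δ x * δ y) *
        ((1 - oracleSign x b.1 * oracleSign y b.1) * (‖A.state x t b‖ * ‖A.state y t b‖)) := by
    rw [progress, progress, ← Finset.sum_sub_distrib, Finset.sum_comm]
    refine Finset.sum_le_sum fun x _ => ?_
    rw [Finset.sum_comm, ← Finset.sum_sub_distrib]
    refine Finset.sum_le_sum fun y _ => ?_
    rw [← mul_sub, ← Finset.mul_sum]
    refine mul_le_mul_of_nonneg_left ?_ (mul_nonneg (hG x y) (mul_nonneg (hδ x) (hδ y)))
    rw [QueryAlgorithm.state, QueryAlgorithm.state, overlap_unitary]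
    exact overlap_sub_overlap_phaseOracle_le x y _ _
  have h2 : ∀ b : QBasis N A.work, ∑ x, ∑ y, G x y * (δ x * δ y) *
        ((1 - oracleSign x b.1 * oracleSign y b.1) * (‖A.state x t b‖ * ‖A.state y t b‖)) ≤
      2 * c * ∑ x, δ x ^ 2 * ‖A.state x t b‖ ^ 2 := by
    rintro ⟨_ | i, z⟩
    · simp only [oracleSign, mul_one, sub_self, zero_mul, mul_zero, Finset.sum_const_zero]
      exact mul_nonneg (by linarith) (Finset.sum_nonneg fun x _ => by positivity)
    · set b : QBasis N A.work := (some i, z)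
      -- For a fixed basis state the loss is twice the form of `Γ_i` at the amplitude-weighted
      -- vector, because the sign factor is `2` where the bits differ and `0` elsewhere. Summing
      -- over basis states then uses that states are unit vectors.
      have h3 := (quadForm_le_specNorm (queryMatrix G i) fun x => δ x * ‖A.state x t b‖).trans
        (mul_le_mul_of_nonneg_right (hc i) (Finset.sum_nonneg fun x _ => sq_nonneg _))
      have h4 : ∑ x, ∑ y, G x y * (δ x * δ y) *
          ((1 - oracleSign x (some i) * oracleSign y (some i)) *
            (‖A.state x t b‖ * ‖A.state y t b‖)) =
          2 * quadForm (queryMatrix G i) fun x => δ x * ‖A.state x t b‖ := by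
        rw [quadForm, Finset.mul_sum]
        refine Finset.sum_congr rfl fun x _ => ?_
        rw [Finset.mul_sum]
        refine Finset.sum_congr rfl fun y _ => ?_
        simp only [queryMatrix, oracleSign]
        cases x i <;> cases y i <;> simp <;> ring
      change ∑ x, ∑ y, G x y * (δ x * δ y) *
          ((1 - oracleSign x (some i) * oracleSign y (some i)) *
            (‖A.state x t b‖ * ‖A.state y t b‖)) ≤ _
      rw [h4]
      simp only [mul_pow] at h3
      linarith
  refine (h1.trans (Finset.sum_le_sum fun b _ => h2 b)).trans_eq ?_
  rw [← Finset.mul_sum, Finset.sum_comm]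
  congr 1
  refine Finset.sum_congr rfl fun x _ => ?_
  rw [← Finset.mul_sum, norm_sq_state, mul_one]

lemma le_two_mul_sqrt_of_forall {ε D v : ℝ} (h0 : 0 ≤ ε) (h2 : ε ≤ 1 / 2) (hD : 1 - 2 * ε ≤ D)
    (h : ∀ τ : ℝ, 0 < τ → v ≤ (τ * (1 + D) + τ⁻¹ * (1 - D)) / 2) :
    v ≤ 2 * Real.sqrt (ε * (1 - ε)) := by
  rcases h0.eq_or_lt with rfl | hε
  · simp only [zero_mul, Real.sqrt_zero, mul_zero]
    have hD1 : 1 ≤ D := by linarith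
    refine le_of_forall_pos_le_add fun η hη => ?_
    have h1 := h (η / (1 + D)) (by positivity)
    have h3 : 0 ≤ (η / (1 + D))⁻¹ * (D - 1) := mul_nonneg (by positivity) (by linarith)
    have h4 : η / (1 + D) * (1 + D) = η := div_mul_cancel₀ _ (by linarith)
    linarith
  · have hε' : 0 < 1 - ε := by linarith
    set a := Real.sqrt ε with ha
    set b := Real.sqrt (1 - ε) with hb
    have ha0 : 0 < a := Real.sqrt_pos.2 hε
    have hb0 : 0 < b := Real.sqrt_pos.2 hε'
    have ha2 : a ^ 2 = ε := Real.sq_sqrt h0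
    have hb2 : b ^ 2 = 1 - ε := Real.sq_sqrt hε'.le
    have hab : a ≤ b := Real.sqrt_le_sqrt (by linarith)
    -- `τ = √(ε/(1-ε))` is the minimizer for `D = 1 - 2ε`. As `τ ≤ τ⁻¹`, a larger `D` only helps;
    -- for `ε = 0` the minimizer degenerates, hence the limit `τ → 0` above.
    have h1 := h (a / b) (by positivity)
    rw [inv_div] at h1
    have h3 : a / b ≤ b / a := by
      rw [div_le_div_iff₀ hb0 ha0]
      nlinarith
    have h4 : a / b * (1 - ε) = a * b := by
      rw [← hb2]
      field_simp
    have h5 : b / a * ε = a * b := by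
      rw [← ha2]
      field_simp
    rw [Real.sqrt_mul h0]
    nlinarith

lemma sum_outputProb_le_one (A : QueryAlgorithm N α) (x : Fin N → Bool) {a a' : α} (h : a ≠ a') :
    A.outputProb x a + A.outputProb x a' ≤ 1 := by
  rw [← norm_sq_state A x A.queries, QueryAlgorithm.outputProb, QueryAlgorithm.outputProb,
    ← Finset.sum_add_distrib]
  refine Finset.sum_le_sum fun b _ => ?_
  have : 0 ≤ ‖A.state x A.queries b‖ ^ 2 := sq_nonneg _
  split_ifs with h1 h2 <;> first | linarith | exact absurd (h1.symm.trans h2) h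

/-- The final states on two inputs with different outputs are nearly orthogonal. -/
lemma overlap_final_le (A : QueryAlgorithm N α) {S : Set (Fin N → Bool)} {F : (Fin N → Bool) → α}
    {ε : ℝ} (h0 : 0 ≤ ε) (h2 : ε ≤ 1 / 2) (hA : A.Computes S F ε) {x y : Fin N → Bool}
    (hx : x ∈ S) (hy : y ∈ S) (hxy : F x ≠ F y) :
    overlap (A.state x A.queries) (A.state y A.queries) ≤ 2 * Real.sqrt (ε * (1 - ε)) := by
  classical
  have hp := hA x hx
  have hq : A.outputProb y (F x) ≤ ε := by
    have h1 := hA y hy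
    have h3 := sum_outputProb_le_one A y hxy
    linarith
  refine le_two_mul_sqrt_of_forall h0 h2
    (D := A.outputProb x (F x) - A.outputProb y (F x)) (by linarith) fun τ hτ => ?_
  set ψ := A.state x A.queries with hψ
  set φ := A.state y A.queries with hφ
  have hamgm : ∀ s a b : ℝ, 0 < s → a * b ≤ (s * a ^ 2 + s⁻¹ * b ^ 2) / 2 := by
    intro s a b hs
    have h1 : (s * a ^ 2 + s⁻¹ * b ^ 2) / 2 - a * b = s⁻¹ * (s * a - b) ^ 2 / 2 := by
      field_simp
      ring
    have h3 : 0 ≤ s⁻¹ * (s * a - b) ^ 2 / 2 := by positivity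
    linarith
  -- Weighted AM-GM with weight `τ` on the outcomes that yield `F x` and `τ⁻¹` on the others; the
  -- sum depends only on the difference `D` of the two probabilities of the output `F x`.
  have hb : ∀ b, (star (ψ b) * φ b).re ≤
      ((τ - τ⁻¹) * (if A.out b = F x then ‖ψ b‖ ^ 2 else 0) + τ⁻¹ * ‖ψ b‖ ^ 2 +
        ((τ⁻¹ - τ) * (if A.out b = F x then ‖φ b‖ ^ 2 else 0) + τ * ‖φ b‖ ^ 2)) / 2 := by
    intro b
    refine ((le_abs_self _).trans (re_star_mul_le _ _)).trans ?_
    split_ifs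
    · refine (hamgm τ _ _ hτ).trans_eq ?_
      ring
    · refine (hamgm τ⁻¹ _ _ (inv_pos.2 hτ)).trans_eq ?_
      rw [inv_inv]
      ring
  rw [overlap_eq_sum]
  refine (Finset.sum_le_sum fun b _ => hb b).trans_eq ?_
  rw [← Finset.sum_div, Finset.sum_add_distrib, Finset.sum_add_distrib, Finset.sum_add_distrib,
    ← Finset.mul_sum, ← Finset.mul_sum, ← Finset.mul_sum, ← Finset.mul_sum, hψ, hφ,
    norm_sq_state, norm_sq_state]
  have e1 : ∀ x' : Fin N → Bool, A.outputProb x' (F x) =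
      ∑ b, if A.out b = F x then ‖A.state x' A.queries b‖ ^ 2 else 0 := fun _ => rfl
  rw [← e1 x, ← e1 y]
  ring

/-- The spectral adversary bound with an explicit test vector. -/
theorem adversary_bound (A : QueryAlgorithm N α) {S : Set (Fin N → Bool)}
    {F : (Fin N → Bool) → α} {G : Matrix (Fin N → Bool) (Fin N → Bool) ℝ}
    (hG : IsAdversaryMatrix S F G) {δ : (Fin N → Bool) → ℝ} (hδ : ∀ x, 0 ≤ δ x)
    {c : ℝ} (hc0 : 0 ≤ c) (hc : ∀ i, specNorm (queryMatrix G i) ≤ c)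
    {ε : ℝ} (h0 : 0 ≤ ε) (h2 : ε ≤ 1 / 2) (hA : A.Computes S F ε) :
    (1 - 2 * Real.sqrt (ε * (1 - ε))) * quadForm G δ ≤
      A.queries * (2 * c * ∑ x, δ x ^ 2) := by
  have h1 : ∀ t : ℕ, progress A G δ 0 - progress A G δ t ≤ t * (2 * c * ∑ x, δ x ^ 2) := by
    intro t
    induction t with
    | zero => simp
    | succ t ih =>
      have := progress_sub_progress_succ_le A hG.nonneg hδ hc0 hc t
      push_cast
      linarith
  have h3 : progress A G δ A.queries ≤ 2 * Real.sqrt (ε * (1 - ε)) * quadForm G δ := by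
    rw [progress, quadForm, Finset.mul_sum]
    refine Finset.sum_le_sum fun x _ => ?_
    rw [Finset.mul_sum]
    refine Finset.sum_le_sum fun y _ => ?_
    rcases eq_or_ne (G x y) 0 with hz | hz
    · simp [hz]
    have hx : x ∈ S := by
      by_contra h
      exact hz (hG.eq_zero_of_invalid x y (Or.inl h))
    have hy : y ∈ S := by
      by_contra h
      exact hz (hG.eq_zero_of_invalid x y (Or.inr h))
    have hxy : F x ≠ F y := fun h => hz (hG.eq_zero_of_eq x hx y hy h)
    rw [mul_comm (2 * Real.sqrt (ε * (1 - ε)))]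
    exact mul_le_mul_of_nonneg_left (overlap_final_le A h0 h2 hA hx hy hxy)
      (mul_nonneg (hG.nonneg x y) (mul_nonneg (hδ x) (hδ y)))
  have h4 := h1 A.queries
  rw [progress_zero] at h4
  linarith

end Adversary

/-! ### Distance kernels on the inputs of ordered searching -/

/-- The valid input whose leftmost `1` is at the index `k`. -/
def threshold {N : ℕ} (k : Fin N) : Fin N → Bool := fun i => decide (k ≤ i)

lemma threshold_mem_validInputs {N : ℕ} (k : Fin N) : threshold k ∈ validInputs N := by
  refine ⟨fun i j hij => ?_, fun i hi => ?_⟩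
  · intro h
    simp only [threshold, decide_eq_true_eq] at h ⊢
    exact h.trans hij
  · have := k.2
    simp only [threshold, decide_eq_true_eq, Fin.le_def]
    omega

lemma leftmostOne_threshold {N : ℕ} (k : Fin N) : leftmostOne (threshold k) = k + 1 := by
  refine IsLeast.csInf_eq ⟨⟨k, rfl, by simp [threshold]⟩, ?_⟩
  rintro m ⟨i, rfl, hi⟩
  simp only [threshold, decide_eq_true_eq, Fin.le_def] at hi
  omega

lemma threshold_injective {N : ℕ} : Function.Injective (threshold (N := N)) := by
  intro j k h
  have := congrArg leftmostOne h
  rw [leftmostOne_threshold, leftmostOne_threshold] at this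
  exact Fin.ext (by omega)

lemma exists_eq_threshold {N : ℕ} (hN : 1 ≤ N) {x : Fin N → Bool} (hx : x ∈ validInputs N) :
    ∃ k, x = threshold k := by
  have hne : (Finset.univ.filter fun i => x i = true).Nonempty :=
    ⟨⟨N - 1, by omega⟩, by simpa using hx.2 _ (by simp; omega)⟩
  set k := (Finset.univ.filter fun i => x i = true).min' hne with hk
  have hxk : x k = true := by
    simpa using (Finset.univ.filter fun i => x i = true).min'_mem hne
  refine ⟨k, funext fun i => ?_⟩
  rw [Bool.eq_iff_iff, threshold, decide_eq_true_eq]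
  refine ⟨fun h => Finset.min'_le _ _ (by simpa using h), fun h => ?_⟩
  exact hx.1 h hxk

lemma mem_range_threshold {N : ℕ} (hN : 1 ≤ N) (x : Fin N → Bool) :
    x ∈ Set.range (threshold (N := N)) ↔ x ∈ validInputs N := by
  constructor
  · rintro ⟨k, rfl⟩
    exact threshold_mem_validInputs k
  · intro h
    obtain ⟨k, rfl⟩ := exists_eq_threshold hN h
    exact ⟨k, rfl⟩

open Classical in
/-- The matrix on the inputs whose entry at distinct valid inputs is a function of the distance of
their leftmost `1`s. -/
def distMatrix (g : ℕ → ℝ) (N : ℕ) : Matrix (Fin N → Bool) (Fin N → Bool) ℝ := fun x y =>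
  if x ∈ validInputs N ∧ y ∈ validInputs N ∧ x ≠ y then
    g ((leftmostOne x : ℤ) - leftmostOne y).natAbs
  else 0

lemma searchMatrix_eq_distMatrix (N : ℕ) : searchMatrix N = distMatrix invKernel N := by
  ext x y
  simp only [searchMatrix, distMatrix, invKernel, Nat.cast_natAbs]
  push_cast
  rfl

lemma isSymm_distMatrix (g : ℕ → ℝ) (N : ℕ) : (distMatrix g N).IsSymm := by
  ext x y
  rw [Matrix.transpose_apply, distMatrix, distMatrix]
  have h1 : y ≠ x ↔ x ≠ y := ne_comm
  have h2 : ((leftmostOne y : ℤ) - leftmostOne x).natAbs =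
      ((leftmostOne x : ℤ) - leftmostOne y).natAbs := by omega
  rw [h2]
  split_ifs <;> first | rfl | tauto

lemma distMatrix_nonneg {g : ℕ → ℝ} (hg : ∀ d, 0 ≤ g d) {N : ℕ} (x y : Fin N → Bool) :
    0 ≤ distMatrix g N x y := by
  unfold distMatrix
  split_ifs
  · exact hg _
  · exact le_rfl

lemma distMatrix_eq_zero_of_invalid (g : ℕ → ℝ) {N : ℕ} (x y : Fin N → Bool)
    (h : x ∉ validInputs N ∨ y ∉ validInputs N) : distMatrix g N x y = 0 :=
  if_neg (by tauto)

lemma distMatrix_threshold (g : ℕ → ℝ) {N : ℕ} (j k : Fin N) :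
    distMatrix g N (threshold j) (threshold k) =
      if j = k then 0 else g ((j : ℤ) - k).natAbs := by
  unfold distMatrix
  rw [leftmostOne_threshold, leftmostOne_threshold]
  have h : (((j : ℕ) + 1 : ℕ) : ℤ) - ((k : ℕ) + 1 : ℕ) = (j : ℤ) - k := by push_cast; ring
  rw [h]
  simp [threshold_mem_validInputs, threshold_injective.eq_iff]

lemma isAdversaryMatrix_distMatrix {g : ℕ → ℝ} (hg : ∀ d, 0 ≤ g d) {N : ℕ} (hN : 1 ≤ N) :
    IsAdversaryMatrix (validInputs N) (fun x => leftmostOne x) (distMatrix g N) where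
  symm := isSymm_distMatrix g N
  nonneg := distMatrix_nonneg hg
  eq_zero_of_eq x hx y hy hxy := by
    obtain ⟨j, rfl⟩ := exists_eq_threshold hN hx
    obtain ⟨k, rfl⟩ := exists_eq_threshold hN hy
    simp only [leftmostOne_threshold] at hxy
    rw [distMatrix_threshold, if_pos (Fin.ext (by omega))]
  eq_zero_of_invalid := distMatrix_eq_zero_of_invalid g

/-- The valid inputs, listed by their distance from the cut after the index `i`. -/
def cutEnum {N : ℕ} (i : Fin N) : Fin (i + 1) ⊕ Fin (N - 1 - i) → (Fin N → Bool) :=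
  Sum.elim (fun r => threshold ⟨i - r, by omega⟩) (fun s => threshold ⟨i + 1 + s, by omega⟩)

lemma cutEnum_injective {N : ℕ} (i : Fin N) : Function.Injective (cutEnum i) := by
  rintro (r | r) (s | s) h <;> simp only [cutEnum, Sum.elim_inl, Sum.elim_inr] at h <;>
    have h' := congrArg Fin.val (threshold_injective h) <;> simp only at h'
  · exact congrArg Sum.inl (Fin.ext (by omega))
  · omega
  · omega
  · exact congrArg Sum.inr (Fin.ext (by omega))

lemma mem_range_cutEnum {N : ℕ} (hN : 1 ≤ N) (i : Fin N) {x : Fin N → Bool}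
    (hx : x ∈ validInputs N) : x ∈ Set.range (cutEnum i) := by
  obtain ⟨k, rfl⟩ := exists_eq_threshold hN hx
  rcases le_or_gt (k : ℕ) i with h | h
  · refine ⟨Sum.inl ⟨i - k, by omega⟩, ?_⟩
    simp only [cutEnum, Sum.elim_inl]
    exact congrArg threshold (Fin.ext (by simp; omega))
  · refine ⟨Sum.inr ⟨k - i - 1, by omega⟩, ?_⟩
    simp only [cutEnum, Sum.elim_inr]
    exact congrArg threshold (Fin.ext (by simp; omega))

/-- `threshold k` has bit `i` set exactly when `k ≤ i`, so only pairs across the cut survive, at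
distance `(i + 1 + s) - (i - r) = r + s + 1`. -/
lemma specNorm_queryMatrix_distMatrix {g : ℕ → ℝ} (hg : ∀ d, 0 ≤ g d) {N : ℕ} (hN : 1 ≤ N)
    (i : Fin N) :
    specNorm (queryMatrix (distMatrix g N) i) = specNorm (bipHankel g (i + 1) (N - 1 - i)) := by
  have hs : (queryMatrix (distMatrix g N) i).IsSymm := by
    ext x y
    rw [Matrix.transpose_apply, queryMatrix, queryMatrix, (isSymm_distMatrix g N).apply]
    simp only [ne_comm]
  have h0 : ∀ x y, 0 ≤ queryMatrix (distMatrix g N) i x y := fun x y => by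
    unfold queryMatrix
    split_ifs
    · exact distMatrix_nonneg hg x y
    · exact le_rfl
  rw [← specNorm_submatrix (cutEnum_injective i) hs h0]
  · congr 1
    ext (r | r) (s | s) <;>
      simp only [Matrix.submatrix_apply, cutEnum, Sum.elim_inl, Sum.elim_inr, queryMatrix,
        distMatrix_threshold, bipHankel, Matrix.fromBlocks_apply₁₁, Matrix.fromBlocks_apply₁₂,
        Matrix.fromBlocks_apply₂₁, Matrix.fromBlocks_apply₂₂, Matrix.zero_apply, Matrix.of_apply]
    · rw [if_neg]
      simp [threshold, Fin.le_def]
    · rw [if_pos, if_neg]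
      · congr 1
        push_cast
        omega
      · simp only [Fin.mk.injEq]
        omega
      · simp [threshold, Fin.le_def]
        omega
    · rw [if_pos, if_neg]
      · congr 1
        push_cast
        omega
      · simp only [Fin.mk.injEq]
        omega
      · simp [threshold, Fin.le_def]
        omega
    · rw [if_neg]
      simp [threshold, Fin.le_def]
      omega
  · intro x y h
    unfold queryMatrix
    rw [distMatrix_eq_zero_of_invalid, ite_self]
    exact h.imp (mt (mem_range_cutEnum hN i)) (mt (mem_range_cutEnum hN i))

/-- The sum of `g |j - k|` over the ordered pairs of distinct `j, k < N`. -/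
def pairSum (g : ℕ → ℝ) (N : ℕ) : ℝ :=
  ∑ j ∈ Finset.range N, ∑ k ∈ Finset.range N, if j = k then 0 else g ((j : ℤ) - k).natAbs

lemma pairSum_succ (g : ℕ → ℝ) (N : ℕ) :
    pairSum g (N + 1) = pairSum g N + 2 * ∑ d ∈ Finset.range N, g (d + 1) := by
  have h1 : ∑ k ∈ Finset.range N, (if N = k then 0 else g ((N : ℤ) - k).natAbs) =
      ∑ d ∈ Finset.range N, g (d + 1) := by
    rw [← Finset.sum_range_reflect]
    refine Finset.sum_congr rfl fun k hk => ?_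
    have := Finset.mem_range.1 hk
    rw [if_neg (by omega)]
    congr 1
    omega
  have h2 : ∑ j ∈ Finset.range N, (if j = N then 0 else g ((j : ℤ) - N).natAbs) =
      ∑ d ∈ Finset.range N, g (d + 1) := by
    rw [← h1]
    refine Finset.sum_congr rfl fun k _ => ?_
    rw [show ((k : ℤ) - N).natAbs = ((N : ℤ) - k).natAbs by omega]
    simp only [eq_comm]
  rw [pairSum, Finset.sum_range_succ]
  simp only [Finset.sum_range_succ, Finset.sum_add_distrib]
  rw [h1, h2, if_pos trivial, pairSum]
  ring

lemma quadForm_distMatrix_indicator (g : ℕ → ℝ) {N : ℕ} (hN : 1 ≤ N) :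
    quadForm (distMatrix g N) ((validInputs N).indicator 1) = pairSum g N := by
  rw [quadForm_submatrix threshold_injective]
  · simp only [quadForm, pairSum, Finset.sum_range, Matrix.submatrix_apply, distMatrix_threshold,
      Function.comp_apply, Set.indicator_of_mem (threshold_mem_validInputs _), Pi.one_apply,
      mul_one, Fin.ext_iff]
  · intro x y h
    rw [mem_range_threshold hN, mem_range_threshold hN] at h
    exact distMatrix_eq_zero_of_invalid g x y h

lemma sum_sq_indicator_validInputs {N : ℕ} (hN : 1 ≤ N) :
    ∑ x, (validInputs N).indicator (1 : (Fin N → Bool) → ℝ) x ^ 2 = N := by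
  rw [sum_eq_sum_of_injective threshold_injective]
  · simp [Set.indicator_of_mem (threshold_mem_validInputs _)]
  · intro x hx
    rw [mem_range_threshold hN] at hx
    simp [Set.indicator_of_notMem hx]

/-! ### The bounds for ordered searching -/

lemma specNorm_queryMatrix_searchMatrix_le_pi {N : ℕ} (hN : 1 ≤ N) (i : Fin N) :
    specNorm (queryMatrix (searchMatrix N) i) ≤ Real.pi := by
  rw [searchMatrix_eq_distMatrix, specNorm_queryMatrix_distMatrix invKernel_nonneg hN]
  refine specNorm_bipHankel_le invKernel_nonneg Real.pi_pos.le fun x y hx hy => ?_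
  have := hilbert_inequality (Finset.range (i + 1)) (Finset.range (N - 1 - i)) hx hy
  simp only [invKernel]
  push_cast
  linarith

/-- The Rayleigh quotient at the indicator of the valid inputs. In the induction the form grows by
`2 H_{n+1}`, while the target grows by `H_{n+1} + 1`. -/
lemma harmonic_le_specNorm_searchMatrix {N : ℕ} (hN : 1 ≤ N) :
    ((harmonic (N - 1) : ℚ) : ℝ) ≤ specNorm (searchMatrix N) := by
  have hsum : ∀ n : ℕ, ∑ d ∈ Finset.range n, invKernel (d + 1) = ((harmonic n : ℚ) : ℝ) := by
    intro n
    simp [harmonic, invKernel]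
  have h1 : ∀ n : ℕ, ((n : ℝ) + 1) * ((harmonic n : ℚ) : ℝ) ≤ pairSum invKernel (n + 1) := by
    intro n
    induction n with
    | zero => simp [pairSum]
    | succ n ih =>
      rw [pairSum_succ, hsum]
      have h2 : ((harmonic (n + 1) : ℚ) : ℝ) = ((harmonic n : ℚ) : ℝ) + 1 / ((n : ℝ) + 1) := by
        rw [harmonic_succ]
        push_cast
        rw [one_div]
      have h3 : (1 : ℝ) ≤ ((harmonic (n + 1) : ℚ) : ℝ) := by
        rw [← hsum, Finset.sum_range_succ']
        have : 0 ≤ ∑ k ∈ Finset.range n, invKernel (k + 1 + 1) :=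
          Finset.sum_nonneg fun k _ => invKernel_nonneg _
        have h4 : invKernel (0 + 1) = 1 := by simp [invKernel]
        linarith
      have h5 : ((n : ℝ) + 1) * ((harmonic (n + 1) : ℚ) : ℝ) =
          ((n : ℝ) + 1) * ((harmonic n : ℚ) : ℝ) + 1 := by
        rw [h2, mul_add, mul_one_div_cancel (by positivity)]
      push_cast
      linarith
  obtain ⟨n, rfl⟩ := Nat.exists_eq_add_of_le' hN
  rw [Nat.add_sub_cancel, searchMatrix_eq_distMatrix]
  have h2 := quadForm_le_specNorm (distMatrix invKernel (n + 1))
    ((validInputs (n + 1)).indicator 1)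
  rw [quadForm_distMatrix_indicator _ hN, sum_sq_indicator_validInputs hN] at h2
  have h3 := (h1 n).trans h2
  push_cast at h3
  rw [mul_comm] at h3
  exact le_of_mul_le_mul_right h3 (by positivity)

/-! ### The half-integer kernel and the query bounds. -/

/-- The kernel `1 / (d - 1/2)`. -/
def halfKernel (d : ℕ) : ℝ := if d = 0 then 0 else 1 / ((d : ℝ) - 1 / 2)

lemma halfKernel_succ (d : ℕ) : halfKernel (d + 1) = 1 / ((d : ℝ) + 1 / 2) := by
  rw [halfKernel, if_neg d.succ_ne_zero]
  push_cast
  congr 1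
  ring

/-- The formula would give `-2` at `d = 0`; the value `0` there restores the sign and never enters
the matrices. -/
lemma halfKernel_nonneg (d : ℕ) : 0 ≤ halfKernel d := by
  rcases d with _ | d
  · simp [halfKernel]
  · rw [halfKernel_succ]
    positivity

lemma specNorm_queryMatrix_halfKernel_le_pi {N : ℕ} (hN : 1 ≤ N) (i : Fin N) :
    specNorm (queryMatrix (distMatrix halfKernel N) i) ≤ Real.pi := by
  rw [specNorm_queryMatrix_distMatrix halfKernel_nonneg hN]
  refine specNorm_bipHankel_le halfKernel_nonneg Real.pi_pos.le fun x y _ _ => ?_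
  have := hilbert_inequality_half (Finset.range (i + 1)) (Finset.range (N - 1 - i)) x y
  simp only [halfKernel_succ]
  push_cast
  linarith

lemma log_succ_sub_log_le {n : ℝ} (hn : 0 < n) : Real.log (n + 1) - Real.log n ≤ 1 / n := by
  rw [← Real.log_div (by positivity) hn.ne']
  refine (Real.log_le_sub_one_of_pos (by positivity)).trans_eq ?_
  field_simp
  ring

/-- From `n + 1` to `n + 2` inputs, `N ln N` grows by at most `ln (n + 2) + 1`, and `h1` says that
the row sums of the kernel are at least this large. -/
lemma log_le_pairSum_halfKernel {N : ℕ} (hN : 1 ≤ N) :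
    2 * (N * Real.log N) ≤ pairSum halfKernel N := by
  have h1 : ∀ n : ℕ, 1 + Real.log ((n : ℝ) + 2) ≤
      ∑ d ∈ Finset.range (n + 1), halfKernel (d + 1) := by
    intro n
    induction n with
    | zero =>
      have := Real.log_two_lt_d9
      simp [halfKernel_succ]
      linarith
    | succ n ih =>
      rw [Finset.sum_range_succ, halfKernel_succ]
      have h2 := log_succ_sub_log_le (n := (n : ℝ) + 2) (by positivity)
      have h3 : 1 / ((n : ℝ) + 2) ≤ 1 / (((n + 1 : ℕ) : ℝ) + 1 / 2) := by
        refine one_div_le_one_div_of_le (by positivity) ?_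
        push_cast
        linarith
      have h4 : (((n + 1 : ℕ) : ℝ) + 2) = (n : ℝ) + 2 + 1 := by push_cast; ring
      rw [h4]
      linarith
  obtain ⟨n, rfl⟩ := Nat.exists_eq_add_of_le' hN
  clear hN
  induction n with
  | zero => simp [pairSum]
  | succ n ih =>
    rw [pairSum_succ]
    have h2 := h1 n
    have h3 := log_succ_sub_log_le (n := (n : ℝ) + 1) (by positivity)
    have h4 : ((n : ℝ) + 1) * (Real.log ((n : ℝ) + 1 + 1) - Real.log ((n : ℝ) + 1)) ≤ 1 := by
      refine (mul_le_mul_of_nonneg_left h3 (by positivity)).trans_eq ?_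
      field_simp
    push_cast at ih ⊢
    rw [show (n : ℝ) + 2 = n + 1 + 1 by ring] at h2
    linarith

lemma query_lower_bound {N : ℕ} (hN : 1 ≤ N) {ε : ℝ} (h0 : 0 ≤ ε) (h2 : ε ≤ 1 / 2)
    (A : QueryAlgorithm N ℕ)
    (hA : A.Computes (validInputs N) (fun x => leftmostOne x) ε) :
    (1 - 2 * Real.sqrt (ε * (1 - ε))) * (Real.log N / Real.pi) ≤ A.queries := by
  have hN' : (0 : ℝ) < N := by exact_mod_cast hN
  have h1 := adversary_bound A (isAdversaryMatrix_distMatrix halfKernel_nonneg hN)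
    (δ := (validInputs N).indicator 1)
    (fun x => Set.indicator_nonneg (fun _ _ => zero_le_one) x) Real.pi_pos.le
    (specNorm_queryMatrix_halfKernel_le_pi hN) h0 h2 hA
  rw [quadForm_distMatrix_indicator _ hN, sum_sq_indicator_validInputs hN] at h1
  have h3 : 0 ≤ 1 - 2 * Real.sqrt (ε * (1 - ε)) := by
    have : Real.sqrt (ε * (1 - ε)) ≤ 1 / 2 :=
      Real.sqrt_le_iff.2 ⟨by norm_num, by nlinarith [sq_nonneg (ε - 1 / 2)]⟩
    linarith
  have h4 := (mul_le_mul_of_nonneg_left (log_le_pairSum_halfKernel hN) h3).trans h1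
  rw [← mul_div_assoc, div_le_iff₀ Real.pi_pos]
  refine le_of_mul_le_mul_right ?_ (by positivity : 0 < 2 * (N : ℝ))
  linarith

/-- The real bound is rounded up so that it can be compared with an infimum in `ℕ∞`. -/
lemma ofReal_le_queryComplexity {N : ℕ} (hN : 1 ≤ N) {ε : ℝ} (h0 : 0 ≤ ε) (h2 : ε ≤ 1 / 2) :
    ENNReal.ofReal ((1 - 2 * Real.sqrt (ε * (1 - ε))) * (Real.log N / Real.pi)) ≤
      (queryComplexity (validInputs N) (fun x => leftmostOne x) ε : ENNReal) := by
  set c := (1 - 2 * Real.sqrt (ε * (1 - ε))) * (Real.log N / Real.pi) with hc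
  have h1 : ((⌈c⌉₊ : ℕ) : ℕ∞) ≤ queryComplexity (validInputs N) (fun x => leftmostOne x) ε := by
    refine le_iInf₂ fun A hA => ?_
    exact_mod_cast Nat.ceil_le.2 (query_lower_bound hN h0 h2 A hA)
  calc ENNReal.ofReal c ≤ ENNReal.ofReal (⌈c⌉₊ : ℝ) := ENNReal.ofReal_le_ofReal (Nat.le_ceil c)
    _ = (((⌈c⌉₊ : ℕ) : ℕ∞) : ENNReal) := by simp
    _ ≤ _ := by exact_mod_cast h1

lemma exact_query_bound {N : ℕ} (hN : 1 ≤ N) :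
    ENNReal.ofReal (0.45 * Real.logb 2 N) ≤
      ENNReal.ofReal 2.04 *
        (queryComplexity (validInputs N) (fun x => leftmostOne x) 0 : ENNReal) := by
  have h1 := ofReal_le_queryComplexity hN (ε := 0) le_rfl (by norm_num)
  simp only [zero_mul, Real.sqrt_zero, mul_zero, sub_zero, one_mul] at h1
  refine le_trans ?_ (mul_le_mul_right h1 _)
  rw [← ENNReal.ofReal_mul (by norm_num)]
  refine ENNReal.ofReal_le_ofReal ?_
  have hlog : 0 ≤ Real.log N := Real.log_natCast_nonneg N
  have hl2 := Real.log_two_gt_d9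
  have hpi := Real.pi_lt_d4
  rw [Real.logb, ← mul_div_assoc, ← mul_div_assoc,
    div_le_div_iff₀ (by linarith) Real.pi_pos]
  -- The constant `2.04` rounds up `0.45 π / ln 2 ≈ 2.0396`.
  have : 0.45 * Real.pi ≤ 2.04 * Real.log 2 := by norm_num at hl2 hpi ⊢; linarith
  nlinarith

end

end OrderedSearch

theorem mainTheorem3 (N : ℕ) (hN : 1 ≤ N) :
    -- the search matrix is a spectral adversary matrix for ordered searching
    OrderedSearch.IsAdversaryMatrix (OrderedSearch.validInputs N)
      (fun x => OrderedSearch.leftmostOne x) (OrderedSearch.searchMatrix N) ∧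
    -- its spectral norm
    ((harmonic (N - 1) : ℚ) : ℝ) ≤ OrderedSearch.specNorm (OrderedSearch.searchMatrix N) ∧
    Real.log N ≤ ((harmonic (N - 1) : ℚ) : ℝ) ∧
    -- the norms of the query matrices are maximized at the index ⌊N/2⌋ of {1, …, N}
    (∀ i j : Fin N, (j : ℕ) + 1 = N / 2 →
      OrderedSearch.specNorm
          (OrderedSearch.queryMatrix (OrderedSearch.searchMatrix N) i) ≤
        OrderedSearch.specNorm
          (OrderedSearch.queryMatrix (OrderedSearch.searchMatrix N) j)) ∧
    -- and they are at most the norm of the infinite Hilbert matrix, which is π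
    (∃ H : lp (fun _ : ℕ => ℝ) 2 →L[ℝ] lp (fun _ : ℕ => ℝ) 2,
      OrderedSearch.IsHilbertOperator H ∧ ‖H‖ = Real.pi ∧
      ∀ i : Fin N,
        OrderedSearch.specNorm
          (OrderedSearch.queryMatrix (OrderedSearch.searchMatrix N) i) ≤ ‖H‖) ∧
    -- the lower bound on the bounded-error quantum query complexity of ordered searching
    (∀ ε : ℝ, 0 ≤ ε → ε ≤ 1 / 2 →
      ENNReal.ofReal ((1 - 2 * Real.sqrt (ε * (1 - ε))) * (Real.log N / Real.pi)) ≤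
        (OrderedSearch.queryComplexity (OrderedSearch.validInputs N)
          (fun x => OrderedSearch.leftmostOne x) ε : ENNReal)) ∧
    -- 0.45 log₂ N queries are within a factor 2.04 of the exact quantum query complexity
    ENNReal.ofReal (0.45 * Real.logb 2 N) ≤
      ENNReal.ofReal 2.04 *
        (OrderedSearch.queryComplexity (OrderedSearch.validInputs N)
          (fun x => OrderedSearch.leftmostOne x) 0 : ENNReal) := by
  refine ⟨?_, OrderedSearch.harmonic_le_specNorm_searchMatrix hN, ?_, fun i j hj => ?_,
    ⟨OrderedSearch.hilbertOperator, OrderedSearch.isHilbertOperator_hilbertOperator,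
      OrderedSearch.norm_hilbertOperator, fun i => ?_⟩,
    fun ε h0 h2 => OrderedSearch.ofReal_le_queryComplexity hN h0 h2,
    OrderedSearch.exact_query_bound hN⟩
  · rw [OrderedSearch.searchMatrix_eq_distMatrix]
    exact OrderedSearch.isAdversaryMatrix_distMatrix OrderedSearch.invKernel_nonneg hN
  · have := log_add_one_le_harmonic (N - 1)
    rwa [Nat.sub_add_cancel hN] at this
  · rw [OrderedSearch.searchMatrix_eq_distMatrix,
      OrderedSearch.specNorm_queryMatrix_distMatrix OrderedSearch.invKernel_nonneg hN,
      OrderedSearch.specNorm_queryMatrix_distMatrix OrderedSearch.invKernel_nonneg hN]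
    have h := OrderedSearch.specNorm_bipHankel_le_balanced (i + 1) (N - 1 - i)
    have e1 : (i : ℕ) + 1 + (N - 1 - i) = N := by omega
    -- The zero-based index `j` cuts the inputs into `j + 1 = N / 2` and `N - 1 - j`, which is the
    -- balanced split.
    have e2 : N - N / 2 = N - 1 - j := by omega
    rwa [e1, e2, ← hj] at h
  · rw [OrderedSearch.norm_hilbertOperator]
    exact OrderedSearch.specNorm_queryMatrix_searchMatrix_le_pi hN i
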